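/- **Theorem (Norm Principle for the unitary group).** Let $R$ be a commutative semilocal ring (that is, with only finitely many maximal ideals) all of whose residue fields $R/\mathfrak m$ are infinite and of characteristic different from $2$. Let $(A,\sigma)$ be an Azumaya algebra with unitary involution over $R$: $A$ is an $R$-algebra with center $C$, $A$ is an Azumaya algebra over $C$, $C$ is an étale quadratic extension of $R$ (finite étale of constant rank $2$), $\sigma$ is an $R$-linear anti-automorphism of $A$ with $\sigma^2=\mathrm{id}$, and $\{c\in C : c^\sigma=c\}=R$. Let $\mathrm{Nrd}_C : A\to C$ be the reduced norm, i.e. the unique multiplicative map such that for every commutative $C$-algebra $S$ and every isomorphism of $S$-algebras $\varphi: S\otimes_C A\to M_n(S)$ the image of $\mathrm{Nrd}_C(a)$ in $S$ is $\det\varphi(1\otimes a)$, for all $a\in A$. Let $U(A)=\{a\in A : a\,a^\sigma=1\}$ be the unitary group. Then $\mathrm{Nrd}_C$ is well defined (such a map exists and is unique), and $$\mathrm{Nrd}_C(U(A))=\mathrm{Nrd}_C(A^*)^{1-\sigma},$$ where $c^{1-\sigma}=c\,(c^\sigma)^{-1}$ for $c\in C^*$. -/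

import Mathlib

open scoped TensorProduct

/-- An `R`-algebra as an algebra over its center; the scalar action is multiplication in `A`. -/
instance centerAlgebra (R : Type*) (A : Type*) [CommRing R] [Ring A] [Algebra R A] :
    Algebra (Subalgebra.center R A) A where
  algebraMap := (Subalgebra.center R A).val.toRingHom
  commutes' c a := (Subalgebra.mem_center_iff.1 c.2 a).symm
  smul_def' _ _ := rfl

/-- A multiplicative map `N : A → C` is a reduced norm of the `C`-algebra `A` if it becomes the
determinant under every splitting of `A`: for every commutative `C`-algebra `S` and every
isomorphism of `S`-algebras `φ : S ⊗ A ≃ Mₙ(S)`, the image of `N a` in `S` is `det (φ (1 ⊗ a))`.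
For an Azumaya algebra there is exactly one such map. The degree `n` may vary with the splitting,
since the rank of `A` over `C` need not be constant when `C` is not connected. -/
def IsReducedNorm.{u, v} (C : Type u) (A : Type v) [CommRing C] [Ring A] [Algebra C A] (N : A →* C) :
    Prop :=
  ∀ (S : Type u) [CommRing S] [Algebra C S] (n : ℕ)
    (φ : S ⊗[C] A ≃ₐ[S] Matrix (Fin n) (Fin n) S) (a : A),
    algebraMap C S (N a) = (φ (1 ⊗ₜ[C] a)).det

/-- The reduced norm `Nrd_C : A → C` of an Azumaya algebra `A` over `C`. -/
noncomputable def reducedNorm (C : Type*) (A : Type*) [CommRing C] [Ring A] [Algebra C A] :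
    A →* C :=
  Classical.epsilon (IsReducedNorm C A)

/-- An `R`-linear involution of the `R`-algebra `A`: an `R`-linear anti-automorphism whose square
is the identity. -/
structure LinearInvolution (R : Type*) (A : Type*) [CommRing R] [Ring A] [Algebra R A]
    extends A →ₗ[R] A where
  map_mul' : ∀ x y : A, toFun (x * y) = toFun y * toFun x
  involutive' : ∀ x : A, toFun (toFun x) = x

namespace LinearInvolution

variable {R : Type*} {A : Type*} [CommRing R] [Ring A] [Algebra R A]

instance : CoeFun (LinearInvolution R A) (fun _ => A → A) := ⟨fun σ => σ.toLinearMap⟩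

theorem map_mul (σ : LinearInvolution R A) (x y : A) : σ (x * y) = σ y * σ x := σ.map_mul' x y

theorem apply_apply (σ : LinearInvolution R A) (x : A) : σ (σ x) = x := σ.involutive' x

theorem map_one (σ : LinearInvolution R A) : σ 1 = 1 := by
  have h := σ.map_mul (σ 1) 1
  rw [mul_one, σ.apply_apply, mul_one] at h
  exact h.symm

theorem map_mem_center (σ : LinearInvolution R A) {c : A} (hc : c ∈ Subalgebra.center R A) :
    σ c ∈ Subalgebra.center R A := by
  rw [Subalgebra.mem_center_iff] at hc ⊢
  intro b
  rw [← σ.apply_apply b, ← σ.map_mul, ← σ.map_mul, hc]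

/-- The restriction of the involution to the center `C` of `A`, as a multiplicative map. -/
def onCenter (σ : LinearInvolution R A) : Subalgebra.center R A →* Subalgebra.center R A where
  toFun c := ⟨σ c, σ.map_mem_center c.2⟩
  map_one' := Subtype.ext σ.map_one
  map_mul' x y := by
    ext
    change σ ((x : A) * y) = σ x * σ y
    rw [σ.map_mul]
    exact Subalgebra.mem_center_iff.1 (σ.map_mem_center x.2) _

/-- The unitary group `U(A) = {a | a * σ a = 1}`. -/
def unitaryGroup (σ : LinearInvolution R A) : Subgroup Aˣ where
  carrier := {u | (u : A) * σ u = 1}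
  one_mem' := by
    change (1 : A) * σ 1 = 1
    rw [σ.map_one, mul_one]
  mul_mem' := by
    intro a b (ha : (a : A) * σ a = 1) (hb : (b : A) * σ b = 1)
    change ((a : A) * b) * σ ((a : A) * b) = 1
    rw [σ.map_mul, mul_assoc, ← mul_assoc (b : A), hb, one_mul, ha]
  inv_mem' := by
    intro a (ha : (a : A) * σ a = 1)
    change ((a⁻¹ : Aˣ) : A) * σ ((a⁻¹ : Aˣ) : A) = 1
    have h1 : σ (a : A) = ((a⁻¹ : Aˣ) : A) := by
      rw [← one_mul (σ (a : A)), ← a.inv_mul, mul_assoc, ha, mul_one]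
    rw [← h1, σ.apply_apply, h1, a.inv_mul]

/-- The homomorphism `c ↦ c ^ (1 - σ) = c * (σ c)⁻¹` on the units of the center. -/
def oneSub (σ : LinearInvolution R A) :
    (Subalgebra.center R A)ˣ →* (Subalgebra.center R A)ˣ where
  toFun c := c * (Units.map σ.onCenter c)⁻¹
  map_one' := by simp
  map_mul' x y := by rw [_root_.map_mul, mul_inv, mul_mul_mul_comm]

/-- `(A, σ)` is an Azumaya algebra with unitary involution over `R`: `A` is Azumaya over its
center `C`, `C` is an étale quadratic extension of `R` (finite étale, of constant rank `2`), and
the elements of `C` fixed by `σ` are those of `R`. -/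
structure IsAzumayaUnitary (σ : LinearInvolution R A) : Prop where
  azumaya : IsAzumaya (Subalgebra.center R A) A
  finite : Module.Finite R (Subalgebra.center R A)
  etale : Algebra.Etale R (Subalgebra.center R A)
  rank_eq_two : ∀ p : PrimeSpectrum R, Module.rankAtStalk (Subalgebra.center R A) p = 2
  fixed_iff : ∀ c ∈ Subalgebra.center R A, σ c = c ↔ c ∈ (algebraMap R A).range

end LinearInvolution

/-! Write N for the reduced norm. Since N(σ a) = σ(N a), every relation u σ(a) = a between units
gives N(u) = N(a)^{1-σ}; both inclusions come from such relations. Étaleness, rank two and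
invertibility of 2 provide a central unit d with σ d = -d and d² = δ in R.

For unitary u and t in R, the Cayley-type element a = 1 + u + t d(1 - u) satisfies u σ(a) = a, so
N(U) lies in the right-hand side once some t makes a invertible (`exists_isUnit_cayley`).

Conversely, if x commutes with σ x, then x σ(x)⁻¹ is unitary and has norm N(x)^{1-σ}. Commutation
holds as soon as x - σ x = 2d, which is central. Given b, solve the Sylvester equation b h - h σ(b)
= 2d. Unique solvability forces σ h = h, so x = b h qualifies, and an invertible symmetric h
contributes nothing to N^{1-σ}. Hence every regular b is good. Good units form a group, so for
arbitrary a it suffices to find b with b and ab both regular (`exists_isSylvesterRegular_and_mul`).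

Both choices are generic: over each residue field the bad parameters on a line are finitely many,
infinite residue fields and the Chinese remainder theorem give a common good t, and Nakayama lifts
the conclusion to R.

The reduced norm comes from descent. Over the algebraic closure of a residue field A becomes a
matrix algebra, and a rank-one idempotent there is a point of the smooth scheme of idempotents.
Localizing that scheme at the point gives a flat splitting ring. A finite product of these is
faithfully flat over C, and determinants descend because algebra endomorphisms of matrix rings
preserve them. Uniqueness gives compatibility with σ. -/

/-! ### Determinants and splitting by a rank-one idempotent -/

/-- A local form of Skolem–Noether: near any maximal ideal there is an intertwiner W with φ(Y) W = W
Y and invertible determinant. Comparing determinants then suffices, without inverting anything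
globally. -/
theorem Matrix.det_algHom_apply {T n : Type*} [CommRing T] [Fintype n] [DecidableEq n]
    (φ : Matrix n n T →ₐ[T] Matrix n n T) (X : Matrix n n T) : (φ X).det = X.det := by
  rcases isEmpty_or_nonempty n with hn | ⟨⟨i₀⟩⟩
  · simp
  by_contra hne
  have hx : (φ X).det - X.det ≠ 0 := sub_ne_zero.2 hne
  set x := (φ X).det - X.det with hxdef
  -- This kernel is the annihilator of the discrepancy x; a maximal ideal m above it is where W will
  -- be built.
  have hker : LinearMap.ker (LinearMap.toSpanSingleton T T x) ≠ ⊤ := fun h ↦ by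
    have : (1 : T) ∈ LinearMap.ker (LinearMap.toSpanSingleton T T x) := h ▸ trivial
    simp only [LinearMap.mem_ker, LinearMap.toSpanSingleton_apply, one_smul] at this
    exact hx this
  obtain ⟨m, hm, hle⟩ := Ideal.exists_le_maximal _ hker
  obtain ⟨r, c, hrc⟩ : ∃ r c, φ (Matrix.single i₀ i₀ 1) r c ∉ m := by
    by_contra! h
    have h' : ((φ (Matrix.single i₀ i₀ 1)).map (Ideal.Quotient.mk m)) = 0 := by
      ext r c
      simpa [Ideal.Quotient.eq_zero_iff_mem] using h r c
    have h1 : ∀ i, (φ (Matrix.single i i 1)).map (Ideal.Quotient.mk m) = 0 := fun i ↦ by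
      have : (Matrix.single i i 1 : Matrix n n T) =
          Matrix.single i i₀ 1 * Matrix.single i₀ i₀ 1 * Matrix.single i₀ i 1 := by simp
      rw [this, map_mul, map_mul, Matrix.map_mul, Matrix.map_mul, h', mul_zero, zero_mul]
    have h2 : (1 : Matrix n n T) = ∑ i, Matrix.single i i 1 := by
      rw [Matrix.sum_single_eq_diagonal, Matrix.diagonal_one]
    have h3 : (Ideal.Quotient.mk m).mapMatrix (φ 1) = 0 := by
      rw [h2, map_sum, map_sum]
      exact Finset.sum_eq_zero fun i _ ↦ h1 i
    rw [map_one, map_one] at h3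
    have : Nontrivial (T ⧸ m) := Ideal.Quotient.nontrivial_iff.2 hm.ne_top
    have : Nonempty n := ⟨i₀⟩
    exact one_ne_zero h3
  -- The map E_{k i₀} ↦ column c of φ(E_{k i₀}), read on the left ideal of matrices supported in
  -- column i₀.
  let W : Matrix n n T := Matrix.of fun k i ↦ φ (Matrix.single i i₀ 1) k c
  have hW : ∀ Y, φ Y * W = W * Y := by
    intro Y
    ext l i
    have h1 : (φ Y * W) l i = (φ (Y * Matrix.single i i₀ 1)) l c := by
      rw [map_mul]; rfl
    have h2 : Y * Matrix.single i i₀ 1 = ∑ k, Y k i • Matrix.single k i₀ (1 : T) := by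
      ext a b
      by_cases hb : b = i₀
      · subst hb
        simp [Matrix.sum_apply, Matrix.single_apply]
      · have hb' : i₀ ≠ b := Ne.symm hb
        simp [Matrix.sum_apply, hb, hb']
    rw [h1, h2, map_sum, Matrix.sum_apply, Matrix.mul_apply]
    refine Finset.sum_congr rfl fun k _ ↦ ?_
    rw [map_smul, Matrix.smul_apply, smul_eq_mul, mul_comm]
    rfl
  -- If W kills u modulo m, then so does W E_{i₀ j}, so u_j times column i₀ of W vanishes; its entry
  -- at r is nonzero modulo m.
  have hdet : W.det ∉ m := by
    intro hmem
    let _ := Ideal.Quotient.field m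
    have h0 : ((Ideal.Quotient.mk m).mapMatrix W).det = 0 := by
      rw [← RingHom.map_det]
      exact Ideal.Quotient.eq_zero_iff_mem.2 hmem
    obtain ⟨u, hu, hWu⟩ := Matrix.exists_mulVec_eq_zero_iff.2 h0
    apply hu
    funext j
    have h1 : (Ideal.Quotient.mk m).mapMatrix W *
        (Ideal.Quotient.mk m).mapMatrix (Matrix.single i₀ j 1) =
        (Ideal.Quotient.mk m).mapMatrix (φ (Matrix.single i₀ j 1)) *
          (Ideal.Quotient.mk m).mapMatrix W := by
      rw [← map_mul, ← map_mul, hW]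
    have h2 : ((Ideal.Quotient.mk m).mapMatrix W).mulVec
        (((Ideal.Quotient.mk m).mapMatrix (Matrix.single i₀ j 1)).mulVec u) = 0 := by
      rw [Matrix.mulVec_mulVec, h1, ← Matrix.mulVec_mulVec, hWu, Matrix.mulVec_zero]
    have h3 := congrFun h2 r
    have h4 : ((Ideal.Quotient.mk m).mapMatrix (Matrix.single i₀ j 1)).mulVec u =
        Pi.single i₀ (u j) := by
      ext k
      rw [RingHom.mapMatrix_apply, Matrix.map_single, map_one, Matrix.single_mulVec]
      simp [Pi.single_apply, Function.update_apply]
    rw [h4] at h3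
    simp only [Matrix.mulVec_single, RingHom.mapMatrix_apply] at h3
    have h5 : Ideal.Quotient.mk m (φ (Matrix.single i₀ i₀ 1) r c) * u j = 0 := by
      simpa [W] using h3
    rcases mul_eq_zero.1 h5 with h | h
    · exact absurd (Ideal.Quotient.eq_zero_iff_mem.1 h) hrc
    · exact h
  -- Taking determinants in φ(X) W = W X shows that det W annihilates x, hence lies in m.
  refine hdet (hle ?_)
  simp only [LinearMap.mem_ker, LinearMap.toSpanSingleton_apply, smul_eq_mul, hxdef]
  have := congrArg Matrix.det (hW X)
  rw [Matrix.det_mul, Matrix.det_mul] at this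
  linear_combination this

theorem Matrix.det_algEquiv_apply_eq {T Λ : Type*} [CommRing T] [Ring Λ] [Algebra T Λ] {m n : ℕ}
    (φ : Λ ≃ₐ[T] Matrix (Fin m) (Fin m) T) (ψ : Λ ≃ₐ[T] Matrix (Fin n) (Fin n) T) (a : Λ) :
    (φ a).det = (ψ a).det := by
  nontriviality T
  have h := (φ.symm.trans ψ).toLinearEquiv.finrank_eq
  simp only [Module.finrank_matrix, Module.finrank_self, Fintype.card_fin, mul_one] at h
  obtain rfl : m = n := Nat.mul_self_inj.1 h
  have := Matrix.det_algHom_apply (φ.symm.trans ψ : _ →ₐ[T] _) (φ a)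
  simpa using this.symm

theorem LinearMap.bijective_of_baseChange_bijective {S K M N : Type*} [CommRing S] [Field K]
    [Algebra S K] [IsLocalHom (algebraMap S K)] [AddCommGroup M] [Module S M] [Module.Free S M]
    [Module.Finite S M] [AddCommGroup N] [Module S N] [Module.Free S N] [Module.Finite S N]
    (f : M →ₗ[S] N) (hf : Function.Bijective (f.baseChange K)) : Function.Bijective f := by
  have : Nontrivial S := (algebraMap S K).domain_nontrivial
  have hrank : Module.finrank S M = Module.finrank S N := by
    rw [← Module.finrank_baseChange (R := K) (M' := M), ← Module.finrank_baseChange (R := K) (M' := N)]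
    exact (LinearEquiv.ofBijective _ hf).finrank_eq
  let b := Module.finBasis S M
  let b' := (Module.finBasis S N).reindex (finCongr hrank.symm)
  have hdet : IsUnit (LinearMap.toMatrix b b' f).det := by
    refine isUnit_of_map_unit (algebraMap S K) _ ?_
    rw [RingHom.map_det, RingHom.mapMatrix_apply, ← LinearMap.toMatrix_baseChange]
    exact (LinearEquiv.ofBijective _ hf).isUnit_det _ _
  rw [← LinearEquiv.coe_ofIsUnitDet hdet]
  exact (LinearEquiv.ofIsUnitDet hdet).bijective

/-- Λ acts on the left ideal Λe, which is projective over the local ring S, hence free. Over K this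
is the action of matrices on column vectors, so Λ → End(Λe) becomes bijective over K, and therefore
is bijective over S. -/
theorem exists_algEquiv_matrix_of_isIdempotentElem {S K Λ : Type*} [CommRing S] [IsLocalRing S]
    [Field K] [Algebra S K] [IsLocalHom (algebraMap S K)] [Ring Λ] [Algebra S Λ] [Module.Free S Λ]
    [Module.Finite S Λ] {n : ℕ} (i₀ : Fin n) (θ : K ⊗[S] Λ ≃ₐ[K] Matrix (Fin n) (Fin n) K)
    (e : Λ) (he : IsIdempotentElem e) (hθ : θ (1 ⊗ₜ e) = Matrix.single i₀ i₀ 1) :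
    Nonempty (Λ ≃ₐ[S] Matrix (Fin n) (Fin n) S) := by
  let P : Submodule Λ Λ := Ideal.span {e}
  let eP : P := ⟨e, Ideal.subset_span rfl⟩
  let π : Λ →ₗ[S] P := (LinearMap.toSpanSingleton Λ P eP).restrictScalars S
  let ι : P →ₗ[S] Λ := P.subtype.restrictScalars S
  have hP : ∀ x : P, (x : Λ) * e = x := by
    rintro ⟨x, hx⟩
    obtain ⟨y, rfl⟩ := Ideal.mem_span_singleton'.1 hx
    change y * e * e = y * e
    rw [mul_assoc, he.eq]
  have hπι : π ∘ₗ ι = LinearMap.id := by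
    ext x
    exact hP x
  have : Module.Projective S P := Module.Projective.of_split ι π hπι
  have : Module.Finite S P := Module.Finite.of_surjective π fun x ↦ ⟨ι x, LinearMap.congr_fun hπι x⟩
  have : Module.Free S P := Module.free_of_flat_of_isLocalRing
  let ψ : Λ →ₐ[S] Module.End S P := Algebra.lsmul S S P
  have hinj : Function.Injective (ψ.toLinearMap.baseChange K) := by
    rw [injective_iff_map_eq_zero]
    intro z hz
    have h1 : ∀ y : Λ, z * (1 ⊗ₜ y) * (1 ⊗ₜ e) = 0 := by
      intro y
      let ev : Module.End S P →ₗ[S] Λ := ι ∘ₗ LinearMap.applyₗ (π y)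
      have h2 : ev ∘ₗ ψ.toLinearMap = LinearMap.mulRight S (y * e) := by
        ext x
        rfl
      have h3 : (LinearMap.mulRight S (y * e)).baseChange K z = 0 := by
        rw [← h2, LinearMap.baseChange_comp, LinearMap.comp_apply, hz, map_zero]
      have h4 : (LinearMap.mulRight S (y * e)).baseChange K = LinearMap.mulRight K (1 ⊗ₜ (y * e)) := by
        ext x
        simp [mul_assoc]
      rw [h4, LinearMap.mulRight_apply] at h3
      rw [mul_assoc, Algebra.TensorProduct.tmul_mul_tmul, one_mul, h3]
    have h2 : ∀ w : K ⊗[S] Λ, z * w * (1 ⊗ₜ e) = 0 := by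
      intro w
      induction w with
      | zero => simp
      | add x y hx hy => rw [mul_add, add_mul, hx, hy, add_zero]
      | tmul k y =>
        have : (k ⊗ₜ[S] y : K ⊗[S] Λ) = k • (1 ⊗ₜ y) := by
          rw [TensorProduct.smul_tmul', smul_eq_mul, mul_one]
        rw [this, mul_smul_comm, smul_mul_assoc, h1, smul_zero]
    apply θ.injective
    rw [map_zero]
    ext r j
    -- Right multiplication by E_{j i₀} moves column j to column i₀, so every column of θ z
    -- vanishes.
    have h3 := congrArg θ (h2 (θ.symm (Matrix.single j i₀ 1)))
    rw [map_mul, map_mul, AlgEquiv.apply_symm_apply, hθ, map_zero, mul_assoc,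
      Matrix.single_mul_single_same] at h3
    simpa using congrFun (congrFun h3 r) i₀
  have hΛ : Module.finrank S Λ = n * n := by
    rw [← Module.finrank_baseChange (R := K), θ.toLinearEquiv.finrank_eq, Module.finrank_matrix]
    simp
  -- Over K, the ideal Λe embeds in the matrices supported in column i₀. The opposite bound comes
  -- from `hinj` by comparing n² with the rank of End P.
  have hPn : Module.finrank S P ≤ n := by
    let col : K ⊗[S] P →ₗ[K] (Fin n → K) :=
      (LinearMap.pi fun r ↦ Matrix.entryLinearMap K K r i₀) ∘ₗ θ.toLinearMap ∘ₗ ι.baseChange K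
    have hι : ∀ x, ι.baseChange K x * (1 ⊗ₜ e) = ι.baseChange K x := by
      intro x
      induction x with
      | zero => simp
      | add x y hx hy => rw [map_add, add_mul, hx, hy]
      | tmul k y => simp [ι, hP]
    have hcol : Function.Injective col := by
      rw [injective_iff_map_eq_zero]
      intro x hx
      have h2 : θ (ι.baseChange K x) = 0 := by
        rw [← hι, map_mul, hθ]
        ext r j
        have := congrFun hx r
        by_cases hj : i₀ = j
        · subst hj
          simpa [col] using this
        · exact Matrix.mul_single_apply_of_ne _ _ _ _ _ (Ne.symm hj) _
      have h3 : ι.baseChange K x = 0 := θ.injective (by rw [h2, map_zero])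
      have h4 := congrArg (π.baseChange K) h3
      rw [← LinearMap.comp_apply, ← LinearMap.baseChange_comp, hπι] at h4
      simpa using h4
    have := LinearMap.finrank_le_finrank_of_injective hcol
    rwa [Module.finrank_baseChange, Module.finrank_fin_fun] at this
  have hEnd : Module.finrank S (Module.End S P) = Module.finrank S P * Module.finrank S P :=
    Module.finrank_linearMap S S P P
  have hle : n * n ≤ Module.finrank S P * Module.finrank S P := by
    have := LinearMap.finrank_le_finrank_of_injective hinj
    rwa [Module.finrank_baseChange, Module.finrank_baseChange, hEnd, hΛ] at this
  have hP' : Module.finrank S P = n := le_antisymm hPn (Nat.mul_self_le_mul_self_iff.1 hle)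
  have hbij : Function.Bijective (ψ.toLinearMap.baseChange K) := by
    refine ⟨hinj, ?_⟩
    refine (LinearMap.injective_iff_surjective_of_finrank_eq_finrank ?_).1 hinj
    rw [Module.finrank_baseChange, Module.finrank_baseChange, hEnd, hΛ, hP']
  have hψ : Function.Bijective ψ := LinearMap.bijective_of_baseChange_bijective (K := K) _ hbij
  let b := (Module.finBasis S P).reindex (finCongr hP')
  exact ⟨(AlgEquiv.ofBijective ψ hψ).trans (algEquivMatrix b)⟩

/-! ### The smooth scheme of idempotents of a free algebra -/

section IdempotentScheme

variable {C A : Type*} [CommRing C] [Ring A] [Algebra C A] {N : ℕ}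

/-- The equations, in coordinates with respect to a basis, that cut out the idempotents of an
algebra. -/
noncomputable def idempotentEquation (b : Module.Basis (Fin N) C A) (l : Fin N) :
    MvPolynomial (Fin N) C :=
  ∑ i, ∑ j, MvPolynomial.C (b.repr (b i * b j) l) * (MvPolynomial.X i * MvPolynomial.X j) -
    MvPolynomial.X l

/-- The coordinate ring of the scheme of idempotents of a free algebra. -/
abbrev IdempotentCoordinateRing (b : Module.Basis (Fin N) C A) : Type _ :=
  MvPolynomial (Fin N) C ⧸ Ideal.span (Set.range (idempotentEquation b))

theorem aeval_idempotentEquation_eq_zero_iff (b : Module.Basis (Fin N) C A) {T : Type*}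
    [CommRing T] [Algebra C T] (x : Fin N → T) :
    (∀ l, MvPolynomial.aeval x (idempotentEquation b l) = 0) ↔
      IsIdempotentElem (∑ i, x i ⊗ₜ[C] b i : T ⊗[C] A) := by
  have key : (∑ i, x i ⊗ₜ[C] b i : T ⊗[C] A) * (∑ i, x i ⊗ₜ[C] b i) - ∑ i, x i ⊗ₜ[C] b i =
      ∑ l, MvPolynomial.aeval x (idempotentEquation b l) • Algebra.TensorProduct.basis T b l := by
    have h1 : ∀ i j, (x i ⊗ₜ[C] b i : T ⊗[C] A) * (x j ⊗ₜ[C] b j) =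
        ∑ l, (algebraMap C T (b.repr (b i * b j) l) * (x i * x j)) ⊗ₜ[C] b l := by
      intro i j
      rw [Algebra.TensorProduct.tmul_mul_tmul]
      conv_lhs => rw [← b.sum_repr (b i * b j), TensorProduct.tmul_sum]
      refine Finset.sum_congr rfl fun l _ ↦ ?_
      rw [TensorProduct.tmul_smul, TensorProduct.smul_tmul', Algebra.smul_def]
    simp only [idempotentEquation, map_sub, map_sum, map_mul, MvPolynomial.aeval_C,
      MvPolynomial.aeval_X, Algebra.TensorProduct.basis_apply, TensorProduct.smul_tmul',
      smul_eq_mul, mul_one, TensorProduct.sub_tmul, Finset.sum_sub_distrib,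
      TensorProduct.sum_tmul, Finset.sum_mul_sum, h1]
    congr 1
    conv_rhs => rw [Finset.sum_comm]
    refine Finset.sum_congr rfl fun i _ ↦ ?_
    rw [Finset.sum_comm]
  rw [IsIdempotentElem, ← sub_eq_zero, key]
  constructor
  · intro h
    simp [h]
  · intro h
    exact Fintype.linearIndependent_iff.1 (Algebra.TensorProduct.basis T b).linearIndependent _ h

theorem isIdempotentElem_sum_of_algHom (b : Module.Basis (Fin N) C A) {T : Type*}
    [CommRing T] [Algebra C T] (f : IdempotentCoordinateRing b →ₐ[C] T) :
    IsIdempotentElem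
      (∑ i, f (Ideal.Quotient.mk _ (MvPolynomial.X i)) ⊗ₜ[C] b i : T ⊗[C] A) := by
  rw [← aeval_idempotentEquation_eq_zero_iff]
  intro l
  have : MvPolynomial.aeval (fun i ↦ f (Ideal.Quotient.mk _ (MvPolynomial.X i))) =
      f.comp (Ideal.Quotient.mkₐ C _) := by
    ext i
    simp
  have hl : Ideal.Quotient.mk (Ideal.span (Set.range (idempotentEquation b)))
      (idempotentEquation b l) = 0 :=
    Ideal.Quotient.eq_zero_iff_mem.2 (Ideal.subset_span ⟨l, rfl⟩)
  rw [this, AlgHom.comp_apply, Ideal.Quotient.mkₐ_eq_mk, hl, map_zero]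

theorem exists_algHom_of_isIdempotentElem (b : Module.Basis (Fin N) C A) {T : Type*}
    [CommRing T] [Algebra C T] (e : T ⊗[C] A) (he : IsIdempotentElem e) :
    ∃ f : IdempotentCoordinateRing b →ₐ[C] T,
      ∀ i, f (Ideal.Quotient.mk _ (MvPolynomial.X i)) = (Algebra.TensorProduct.basis T b).repr e i := by
  have hsum : ∑ i, ((Algebra.TensorProduct.basis T b).repr e i) ⊗ₜ[C] b i = e := by
    conv_rhs => rw [← (Algebra.TensorProduct.basis T b).sum_repr e]
    simp [TensorProduct.smul_tmul']
  have h := (aeval_idempotentEquation_eq_zero_iff b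
    (fun i ↦ (Algebra.TensorProduct.basis T b).repr e i)).2 (by rwa [hsum])
  refine ⟨Ideal.Quotient.liftₐ _
    (MvPolynomial.aeval fun i ↦ (Algebra.TensorProduct.basis T b).repr e i) ?_, ?_⟩
  · have : Ideal.span (Set.range (idempotentEquation b)) ≤
        RingHom.ker (MvPolynomial.aeval fun i ↦ (Algebra.TensorProduct.basis T b).repr e i) :=
      Ideal.span_le.2 (Set.range_subset_iff.2 h)
    exact fun a ha ↦ this ha
  · intro i
    exact MvPolynomial.aeval_X _ i

theorem Algebra.TensorProduct.basis_repr_map {T T' : Type*} [CommRing T] [Algebra C T]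
    [CommRing T'] [Algebra C T'] (b : Module.Basis (Fin N) C A) (g : T →ₐ[C] T')
    (z : T ⊗[C] A) (i : Fin N) :
    (Algebra.TensorProduct.basis T' b).repr (Algebra.TensorProduct.map g (AlgHom.id C A) z) i =
      g ((Algebra.TensorProduct.basis T b).repr z i) := by
  induction z with
  | zero => simp
  | add x y hx hy => simp [hx, hy]
  | tmul t a => simp

/-- Infinitesimal lifting of points is exactly lifting of idempotents along T ⊗ A → (T/I) ⊗ A, whose
kernel consists of nilpotents when I² = 0. -/
instance (b : Module.Basis (Fin N) C A) : Algebra.FormallySmooth C (IdempotentCoordinateRing b) := by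
  refine Algebra.FormallySmooth.of_comp_surjective fun T _ _ I hI f ↦ ?_
  let π : T →ₐ[C] T ⧸ I := Ideal.Quotient.mkₐ C I
  let g : T ⊗[C] A →ₐ[C] (T ⧸ I) ⊗[C] A := Algebra.TensorProduct.map π (AlgHom.id C A)
  have hker : ∀ z ∈ RingHom.ker (g : T ⊗[C] A →+* (T ⧸ I) ⊗[C] A), IsNilpotent z := by
    intro z hz
    have hz' : g z = 0 := hz
    have hzI : ∀ i, (Algebra.TensorProduct.basis T b).repr z i ∈ I := by
      intro i
      rw [← Ideal.Quotient.eq_zero_iff_mem]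
      have := Algebra.TensorProduct.basis_repr_map b π z i
      rw [show Algebra.TensorProduct.map π (AlgHom.id C A) z = 0 from hz'] at this
      rw [map_zero] at this
      exact this.symm
    refine ⟨2, ?_⟩
    rw [pow_two, ← (Algebra.TensorProduct.basis T b).sum_repr z, Finset.sum_mul_sum]
    refine Finset.sum_eq_zero fun i _ ↦ Finset.sum_eq_zero fun j _ ↦ ?_
    have : (Algebra.TensorProduct.basis T b).repr z i * (Algebra.TensorProduct.basis T b).repr z j
        = 0 := by
      rw [← Ideal.mem_bot, ← hI, pow_two]
      exact Ideal.mul_mem_mul (hzI i) (hzI j)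
    rw [smul_mul_smul_comm, this, zero_smul]
  have hsurj : Function.Surjective g :=
    TensorProduct.map_surjective Ideal.Quotient.mk_surjective Function.surjective_id
  obtain ⟨e, he, hge⟩ := exists_isIdempotentElem_eq_of_ker_isNilpotent
    (g : T ⊗[C] A →+* (T ⧸ I) ⊗[C] A) hker _ (hsurj _) (isIdempotentElem_sum_of_algHom b f)
  obtain ⟨F, hF⟩ := exists_algHom_of_isIdempotentElem b e he
  refine ⟨F, ?_⟩
  refine Ideal.Quotient.algHom_ext _ (MvPolynomial.algHom_ext fun i ↦ ?_)
  have h1 := Algebra.TensorProduct.basis_repr_map b π e i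
  rw [show Algebra.TensorProduct.map π (AlgHom.id C A) e = _ from hge] at h1
  simp only [AlgHom.comp_apply, Ideal.Quotient.mkₐ_eq_mk, hF]
  rw [← Ideal.Quotient.mkₐ_eq_mk C, ← h1]
  simp [Finsupp.single_apply]

instance (b : Module.Basis (Fin N) C A) : Algebra.Smooth C (IdempotentCoordinateRing b) where
  finitePresentation :=
    Algebra.FinitePresentation.quotient ⟨(Set.finite_range (idempotentEquation b)).toFinset, by simp⟩

end IdempotentScheme

/-! ### Flat splitting near a geometric point -/

/-- The isomorphism `K ⊗[S] (S ⊗[C] A) ≃ₐ[K] K ⊗[C] A` for a noncommutative algebra `A`. -/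
noncomputable def AlgEquiv.cancelBaseChange (C S K A : Type*) [CommRing C] [CommRing S] [CommRing K]
    [Ring A] [Algebra C S] [Algebra C K] [Algebra S K] [IsScalarTower C S K] [Algebra C A] :
    K ⊗[S] (S ⊗[C] A) ≃ₐ[K] K ⊗[C] A :=
  AlgEquiv.symm <| AlgEquiv.ofLinearEquiv
    (TensorProduct.AlgebraTensorModule.cancelBaseChange C S K K A).symm
    (by simp [Algebra.TensorProduct.one_def]) <|
      LinearMap.map_mul_of_map_mul_tmul (fun _ _ _ _ ↦ by simp)

@[simp]
theorem AlgEquiv.cancelBaseChange_tmul {C S K A : Type*} [CommRing C] [CommRing S] [CommRing K]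
    [Ring A] [Algebra C S] [Algebra C K] [Algebra S K] [IsScalarTower C S K] [Algebra C A]
    (k : K) (s : S) (a : A) :
    AlgEquiv.cancelBaseChange C S K A (k ⊗ₜ (s ⊗ₜ a)) = (s • k) ⊗ₜ a :=
  TensorProduct.AlgebraTensorModule.cancelBaseChange_tmul C S K k a s

theorem isLocalHom_algebraMap_of_ker_eq {B K S : Type*} [CommRing B] [Field K] [CommRing S]
    [Algebra B S] [Algebra S K] (f : B →+* K) (q : Ideal B) [q.IsPrime] [IsLocalization.AtPrime S q]
    (hq : RingHom.ker f = q) (hf : ∀ x, algebraMap S K (algebraMap B S x) = f x) :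
    IsLocalHom (algebraMap S K) := by
  refine ⟨fun x hx ↦ ?_⟩
  obtain ⟨a, s, rfl⟩ := IsLocalization.exists_mk'_eq q.primeCompl x
  have h1 : IsLocalization.mk' S a s * algebraMap B S s = algebraMap B S a :=
    IsLocalization.mk'_spec _ _ _
  rw [IsLocalization.AtPrime.isUnit_mk'_iff S q]
  intro ha
  have h2 : algebraMap S K (algebraMap B S a) = 0 := by
    rwa [hf, ← RingHom.mem_ker, hq]
  rw [← h1, map_mul] at h2
  have hs : algebraMap S K (algebraMap B S s) ≠ 0 := by
    rw [hf, ne_eq, ← RingHom.mem_ker, hq]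
    exact s.2
  exact (mul_ne_zero hx.ne_zero hs) h2

/-- The K-point f is the idempotent E₀₀. Over the local ring S of the idempotent scheme at f, the
universal idempotent specializes to E₀₀, so it splits S ⊗ A; smoothness makes S flat over C. -/
theorem faithfullyFlat_and_nonempty_algEquiv_matrix {C A K S : Type*} [CommRing C]
    [IsLocalRing C] [Ring A] [Algebra C A] [Module.Finite C A] [Field K] [Algebra C K]
    [IsLocalHom (algebraMap C K)] {n N : ℕ} [NeZero n] (b : Module.Basis (Fin N) C A)
    (θ : K ⊗[C] A ≃ₐ[K] Matrix (Fin n) (Fin n) K) (f : IdempotentCoordinateRing b →ₐ[C] K)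
    (hf : ∀ i, f (Ideal.Quotient.mk _ (MvPolynomial.X i)) =
      (Algebra.TensorProduct.basis K b).repr (θ.symm (Matrix.single 0 0 1)) i)
    (q : Ideal (IdempotentCoordinateRing b)) [q.IsPrime] (hq : RingHom.ker f.toRingHom = q)
    [CommRing S] [Algebra (IdempotentCoordinateRing b) S] [IsLocalization.AtPrime S q] [Algebra C S]
    [IsScalarTower C (IdempotentCoordinateRing b) S] :
    Module.FaithfullyFlat C S ∧ Nonempty (S ⊗[C] A ≃ₐ[S] Matrix (Fin n) (Fin n) S) := by
  have hfu : ∀ y : q.primeCompl, IsUnit (f.toRingHom y) := fun y ↦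
    isUnit_iff_ne_zero.2 fun h ↦ y.2 (hq ▸ h)
  let _ : Algebra S K := (IsLocalization.lift hfu : S →+* K).toAlgebra
  have hg : ∀ x, algebraMap S K (algebraMap _ S x) = f x := fun x ↦ IsLocalization.lift_eq hfu x
  have : IsScalarTower C S K := IsScalarTower.of_algebraMap_eq' <| by
    ext x
    rw [RingHom.comp_apply, IsScalarTower.algebraMap_apply C (IdempotentCoordinateRing b) S, hg,
      f.commutes]
  have : IsLocalRing S := IsLocalization.AtPrime.isLocalRing S q
  have hloc : IsLocalHom (algebraMap S K) := isLocalHom_algebraMap_of_ker_eq f.toRingHom q hq hg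
  have : IsLocalHom (algebraMap C S) := by
    have h : IsLocalHom ((algebraMap S K).comp (algebraMap C S)) := by
      rwa [← IsScalarTower.algebraMap_eq]
    exact isLocalHom_of_comp _ (algebraMap S K)
  have : Module.Flat (IdempotentCoordinateRing b) S := IsLocalization.flat S q.primeCompl
  have : Module.Flat C S := Module.Flat.trans C (IdempotentCoordinateRing b) S
  have : Module.Free C A := Module.Free.of_basis b
  refine ⟨Module.FaithfullyFlat.of_flat_of_isLocalHom, ?_⟩
  let θ' : K ⊗[S] (S ⊗[C] A) ≃ₐ[K] Matrix (Fin n) (Fin n) K :=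
    (AlgEquiv.cancelBaseChange C S K A).trans θ
  refine exists_algEquiv_matrix_of_isIdempotentElem 0 θ' _
    (isIdempotentElem_sum_of_algHom b (IsScalarTower.toAlgHom C (IdempotentCoordinateRing b) S)) ?_
  change θ (AlgEquiv.cancelBaseChange C S K A _) = _
  rw [TensorProduct.tmul_sum, map_sum, ← AlgEquiv.eq_symm_apply,
    ← (Algebra.TensorProduct.basis K b).sum_repr (θ.symm _)]
  refine Finset.sum_congr rfl fun i _ ↦ ?_
  rw [← hf, AlgEquiv.cancelBaseChange_tmul, IsScalarTower.coe_toAlgHom',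
    Algebra.smul_def, hg, Algebra.TensorProduct.basis_apply, TensorProduct.smul_tmul']
  simp

theorem exists_faithfullyFlat_algEquiv_matrix.{u, v, w} {C : Type u} {A : Type v} {K : Type w}
    [CommRing C] [IsLocalRing C]
    [Ring A] [Algebra C A] [Module.Free C A] [Module.Finite C A] [Field K] [Algebra C K]
    [IsLocalHom (algebraMap C K)] {n : ℕ} [NeZero n]
    (θ : K ⊗[C] A ≃ₐ[K] Matrix (Fin n) (Fin n) K) :
    ∃ (S : Type u) (_ : CommRing S) (_ : Algebra C S), Module.FaithfullyFlat C S ∧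
      Nonempty (S ⊗[C] A ≃ₐ[S] Matrix (Fin n) (Fin n) S) := by
  let b := Module.finBasis C A
  obtain ⟨f, hf⟩ := exists_algHom_of_isIdempotentElem b (θ.symm (Matrix.single 0 0 1)) <| by
    rw [IsIdempotentElem, ← map_mul, Matrix.single_mul_single_same, mul_one]
  have hq : (RingHom.ker f.toRingHom).IsPrime := RingHom.ker_isPrime _
  exact ⟨Localization.AtPrime (RingHom.ker f.toRingHom), inferInstance, inferInstance,
    faithfullyFlat_and_nonempty_algEquiv_matrix b θ f hf _ rfl⟩

/-- For an Azumaya algebra every C-linear endomorphism is a sum of two-sided multiplications, in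
particular a coordinate functional followed by C → A. Applied to a nonzero element of a two-sided
ideal, a suitable one yields a nonzero scalar in the ideal. -/
theorem IsAzumaya.isSimpleRing_baseChange (C A K : Type*) [CommRing C] [Ring A] [Algebra C A]
    [IsAzumaya C A] [Field K] [Algebra C K] [Nontrivial (K ⊗[C] A)] : IsSimpleRing (K ⊗[C] A) := by
  obtain ⟨n, f, g, -, -, hfg⟩ := Module.Finite.exists_comp_eq_id_of_projective C A
  let φ (i : Fin n) : A →ₗ[C] C := LinearMap.proj i ∘ₗ g
  let F (i : Fin n) : K ⊗[C] A →ₗ[K] K :=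
    (TensorProduct.AlgebraTensorModule.rid C K K).toLinearMap ∘ₗ (φ i).baseChange K
  have hF : ∀ z : K ⊗[C] A, z = ∑ i, F i z • (1 ⊗ₜ[C] f (Pi.single i 1)) := by
    intro z
    induction z with
    | zero => simp
    | add x y hx hy =>
      simp only [map_add, add_smul, Finset.sum_add_distrib]
      rw [← hx, ← hy]
    | tmul k a =>
      have ha : a = ∑ i, φ i a • f (Pi.single i 1) := by
        conv_lhs => rw [← LinearMap.id_apply (R := C) a, ← hfg, LinearMap.comp_apply,
          pi_eq_sum_univ' (g a), map_sum]
        refine Finset.sum_congr rfl fun i _ ↦ ?_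
        rw [map_smul]
        congr 2
      conv_lhs => rw [ha, TensorProduct.tmul_sum]
      refine Finset.sum_congr rfl fun i _ ↦ ?_
      simp [F, TensorProduct.smul_tmul']
  have hI : ∀ (I : TwoSidedIdeal (K ⊗[C] A)) (t : A ⊗[C] Aᵐᵒᵖ) (z : K ⊗[C] A), z ∈ I →
      (AlgHom.mulLeftRight C A t).baseChange K z ∈ I := by
    intro I t z hz
    induction t with
    | zero => simp [I.zero_mem]
    | add x y hx hy =>
      rw [map_add, LinearMap.baseChange_add, LinearMap.add_apply]
      exact I.add_mem hx hy
    | tmul a b =>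
      have : (AlgHom.mulLeftRight C A (a ⊗ₜ b)).baseChange K =
          LinearMap.mulRight K (1 ⊗ₜ b.unop) ∘ₗ LinearMap.mulLeft K (1 ⊗ₜ a) := by
        ext x
        simp
      rw [this]
      exact I.mul_mem_right _ _ (I.mul_mem_left _ _ hz)
  refine ⟨{ eq_bot_or_eq_top := fun I ↦ ?_ }⟩
  rw [or_iff_not_imp_left]
  intro hne
  obtain ⟨z, hz, hz0⟩ : ∃ z ∈ I, z ≠ 0 := by
    by_contra! h
    exact hne (le_bot_iff.1 fun z hz ↦ by simpa using h z hz)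
  obtain ⟨i, hi⟩ : ∃ i, F i z ≠ 0 := by
    by_contra! h
    exact hz0 (by rw [hF z]; simp [h])
  obtain ⟨t, ht⟩ := (IsAzumaya.bij (R := C) (A := A)).2 (Algebra.linearMap C A ∘ₗ φ i)
  have h1 : (Algebra.linearMap C A ∘ₗ φ i).baseChange K = Algebra.linearMap K (K ⊗[C] A) ∘ₗ F i := by
    ext x
    simp [F, Algebra.algebraMap_eq_smul_one, Algebra.TensorProduct.one_def,
      TensorProduct.smul_tmul']
  have h2 := hI I t z hz
  rw [ht, h1] at h2
  rw [← TwoSidedIdeal.one_mem_iff]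
  have h3 : algebraMap K _ (F i z)⁻¹ * algebraMap K _ (F i z) ∈ I := I.mul_mem_left _ _ h2
  rwa [← map_mul, inv_mul_cancel₀ hi, map_one] at h3

theorem IsLocalRing.isLocalHom_algebraMap_algebraicClosure (L : Type*) [CommRing L]
    [IsLocalRing L] : IsLocalHom (algebraMap L (AlgebraicClosure (ResidueField L))) := by
  refine ⟨fun x hx ↦ ?_⟩
  rw [IsScalarTower.algebraMap_apply L (ResidueField L)] at hx
  exact (isUnit_map_iff (residue L) x).1 (isUnit_iff_ne_zero.2 fun h ↦ hx.ne_zero (by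
    rw [ResidueField.algebraMap_eq, h, map_zero]))

theorem IsAzumaya.exists_flat_algEquiv_matrix_of_isLocalization.{u, v} (C : Type u) (A : Type v)
    [CommRing C] [Ring A] [Algebra C A] [IsAzumaya C A] (m : Ideal C) [hm : m.IsMaximal]
    (L : Type u) [CommRing L] [IsLocalRing L] [Algebra C L] [IsLocalization.AtPrime L m] :
    ∃ (S : Type u) (_ : CommRing S) (_ : Algebra C S) (n : ℕ), Module.Flat C S ∧
      m.map (algebraMap C S) ≠ ⊤ ∧ Nonempty (S ⊗[C] A ≃ₐ[S] Matrix (Fin n) (Fin n) S) := by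
  let K := AlgebraicClosure (IsLocalRing.ResidueField L)
  have : Module.Free L (L ⊗[C] A) := Module.free_of_flat_of_isLocalRing
  have : IsLocalHom (algebraMap L K) := IsLocalRing.isLocalHom_algebraMap_algebraicClosure L
  -- A is faithful over C, so its support is the whole spectrum.
  have : Nontrivial (L ⊗[C] A) := by
    have h : (⟨m, hm.isPrime⟩ : PrimeSpectrum C) ∈ Module.support C A := by
      rw [Module.support_eq_zeroLocus, Module.annihilator_eq_bot.2 inferInstance]
      simp
    rw [Module.mem_support_iff] at h
    exact (IsLocalizedModule.iso m.primeCompl (TensorProduct.mk C L A 1)).symm.toEquiv.nontrivial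
  have hpos : 0 < Module.finrank K (K ⊗[L] (L ⊗[C] A)) := by
    rw [Module.finrank_baseChange]
    exact Module.finrank_pos_iff_of_free L (L ⊗[C] A) |>.2 inferInstance
  have : Nontrivial (K ⊗[L] (L ⊗[C] A)) := Module.nontrivial_of_finrank_pos hpos
  let e := AlgEquiv.cancelBaseChange C L K A
  have : Nontrivial (K ⊗[C] A) := e.symm.toEquiv.nontrivial
  have := IsAzumaya.isSimpleRing_baseChange C A K
  obtain ⟨n, hn, ⟨θ⟩⟩ := IsSimpleRing.exists_algEquiv_matrix_of_isAlgClosed K (K ⊗[C] A)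
  obtain ⟨S, _, _, hff, ⟨φ⟩⟩ := exists_faithfullyFlat_algEquiv_matrix (e.trans θ)
  let _ : Algebra C S := ((algebraMap L S).comp (algebraMap C L)).toAlgebra
  have : IsScalarTower C L S := IsScalarTower.of_algebraMap_eq' rfl
  refine ⟨S, inferInstance, inferInstance, n, ?_, ?_, ?_⟩
  · have : Module.Flat C L := IsLocalization.flat L m.primeCompl
    exact Module.Flat.trans C L S
  · intro h
    refine hff.submodule_ne_top (IsLocalRing.maximalIdeal.isMaximal L) ?_
    rw [Ideal.smul_top_eq_map, ← IsLocalization.AtPrime.map_eq_maximalIdeal m, Ideal.map_map,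
      ← IsScalarTower.algebraMap_eq, h]
    rfl
  · exact ⟨(AlgEquiv.cancelBaseChange C L S A).symm.trans φ⟩

theorem IsAzumaya.exists_flat_algEquiv_matrix.{u, v} (C : Type u) (A : Type v) [CommRing C] [Ring A]
    [Algebra C A] [IsAzumaya C A] (m : Ideal C) [hm : m.IsMaximal] :
    ∃ (S : Type u) (_ : CommRing S) (_ : Algebra C S) (n : ℕ), Module.Flat C S ∧
      m.map (algebraMap C S) ≠ ⊤ ∧ Nonempty (S ⊗[C] A ≃ₐ[S] Matrix (Fin n) (Fin n) S) :=
  IsAzumaya.exists_flat_algEquiv_matrix_of_isLocalization C A m (Localization.AtPrime m)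

/-! ### Descent and the existence of the reduced norm -/

/-- Base change of a matrix algebra. -/
noncomputable def Matrix.baseChangeAlgEquiv (S W : Type*) [CommRing S] [CommRing W] [Algebra S W]
    (n : ℕ) : W ⊗[S] Matrix (Fin n) (Fin n) S ≃ₐ[W] Matrix (Fin n) (Fin n) W :=
  AlgEquiv.ofRingEquiv (f := (matrixEquivTensor (Fin n) S W).symm.toRingEquiv) fun w ↦ by
    rw [Algebra.TensorProduct.algebraMap_apply]
    change (matrixEquivTensor (Fin n) S W).symm _ = _
    rw [matrixEquivTensor_apply_symm]
    ext i j
    by_cases h : i = j <;> simp [h, Matrix.algebraMap_matrix_apply]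

theorem Matrix.baseChangeAlgEquiv_one_tmul {S W : Type*} [CommRing S] [CommRing W] [Algebra S W]
    {n : ℕ} (M : Matrix (Fin n) (Fin n) S) :
    Matrix.baseChangeAlgEquiv S W n (1 ⊗ₜ M) = M.map (algebraMap S W) := by
  change (matrixEquivTensor (Fin n) S W).symm _ = _
  rw [matrixEquivTensor_apply_symm]
  simp

theorem exists_algEquiv_matrix_baseChange {C A S W : Type*} [CommRing C] [Ring A] [Algebra C A]
    [CommRing S] [Algebra C S] [CommRing W] [Algebra C W] [Algebra S W] [IsScalarTower C S W] {n : ℕ}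
    (φ : S ⊗[C] A ≃ₐ[S] Matrix (Fin n) (Fin n) S) :
    ∃ ψ : W ⊗[C] A ≃ₐ[W] Matrix (Fin n) (Fin n) W,
      ∀ a, (ψ (1 ⊗ₜ a)).det = algebraMap S W (φ (1 ⊗ₜ a)).det := by
  refine ⟨(AlgEquiv.cancelBaseChange C S W A).symm.trans
    ((Algebra.TensorProduct.congr AlgEquiv.refl φ).trans (Matrix.baseChangeAlgEquiv S W n)), ?_⟩
  intro a
  have h : (AlgEquiv.cancelBaseChange C S W A).symm (1 ⊗ₜ a) = 1 ⊗ₜ (1 ⊗ₜ a) := by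
    rw [AlgEquiv.symm_apply_eq, AlgEquiv.cancelBaseChange_tmul, one_smul]
  rw [AlgEquiv.trans_apply, AlgEquiv.trans_apply, h]
  change (Matrix.baseChangeAlgEquiv S W n (1 ⊗ₜ φ (1 ⊗ₜ a))).det = _
  rw [Matrix.baseChangeAlgEquiv_one_tmul, RingHom.map_det, RingHom.mapMatrix_apply]

/-- Both sides are determinants of the same element under two splittings over S ⊗ S'. This is the
descent condition, and with a second arbitrary splitting it also proves that the descended norm is
correct there. -/
theorem det_tmul_one_eq_one_tmul_det {C A S S' : Type*} [CommRing C] [Ring A] [Algebra C A]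
    [CommRing S] [Algebra C S] [CommRing S'] [Algebra C S'] {n n' : ℕ}
    (φ : S ⊗[C] A ≃ₐ[S] Matrix (Fin n) (Fin n) S)
    (φ' : S' ⊗[C] A ≃ₐ[S'] Matrix (Fin n') (Fin n') S') (a : A) :
    (φ (1 ⊗ₜ a)).det ⊗ₜ[C] (1 : S') = (1 : S) ⊗ₜ[C] (φ' (1 ⊗ₜ a)).det := by
  let _ : Algebra S' (S ⊗[C] S') := Algebra.TensorProduct.rightAlgebra
  obtain ⟨ψ, hψ⟩ := exists_algEquiv_matrix_baseChange (W := S ⊗[C] S') φ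
  obtain ⟨ψ', hψ'⟩ := exists_algEquiv_matrix_baseChange (W := S ⊗[C] S') φ'
  have h := Matrix.det_algEquiv_apply_eq ψ ψ' (1 ⊗ₜ a)
  rw [hψ, hψ'] at h
  exact h

/-- In T ⊗ (T/C) the class of 1 ⊗ x equals that of x ⊗ 1, which is zero; faithful flatness then
kills the class of x in T/C. -/
theorem Module.FaithfullyFlat.exists_algebraMap_eq_of_tmul_eq {C T : Type*} [CommRing C] [CommRing T]
    [Algebra C T] [Module.FaithfullyFlat C T] (x : T) (hx : x ⊗ₜ[C] (1 : T) = 1 ⊗ₜ x) :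
    ∃ c, algebraMap C T c = x := by
  have h1 : (1 : T) ∈ LinearMap.range (Algebra.linearMap C T) := ⟨1, map_one (algebraMap C T)⟩
  have h : (1 : T) ⊗ₜ[C] (LinearMap.range (Algebra.linearMap C T)).mkQ x = 0 := by
    rw [← LinearMap.lTensor_tmul, ← hx, LinearMap.lTensor_tmul, Submodule.mkQ_apply,
      (Submodule.Quotient.mk_eq_zero _).2 h1, TensorProduct.tmul_zero]
  rw [Module.FaithfullyFlat.one_tmul_eq_zero_iff, Submodule.mkQ_apply,
    Submodule.Quotient.mk_eq_zero] at h
  exact h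

section Pi

variable {C ι : Type*} [CommRing C] [Fintype ι] (S : ι → Type*)
  [∀ i, CommRing (S i)] [∀ i, Algebra C (S i)]

theorem Module.FaithfullyFlat.pi_of_map_ne_top [∀ i, Module.Flat C (S i)]
    (h : ∀ m : Ideal C, m.IsMaximal → ∃ i, m.map (algebraMap C (S i)) ≠ ⊤) :
    Module.FaithfullyFlat C (∀ i, S i) := by
  classical
  have : Module.Flat C (∀ i, S i) := .of_linearEquiv (DirectSum.linearEquivFunOnFintype C ι S).symm
  refine ⟨fun m hm htop ↦ ?_⟩
  obtain ⟨i, hi⟩ := h m hm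
  apply hi
  rw [Ideal.smul_top_eq_map] at htop
  have h1 : m.map (algebraMap C (∀ i, S i)) = ⊤ := by
    rw [Ideal.eq_top_iff_one]
    have : (1 : ∀ i, S i) ∈ (Ideal.map (algebraMap C (∀ i, S i)) m).restrictScalars C := by
      rw [htop]; trivial
    exact this
  have h2 : (Pi.evalRingHom S i).comp (algebraMap C (∀ i, S i)) = algebraMap C (S i) := rfl
  rw [← h2, ← Ideal.map_map, h1, Ideal.map_top]

theorem tmul_one_eq_one_tmul_of_pi [DecidableEq ι] (x : ∀ i, S i)
    (hx : ∀ i j, x i ⊗ₜ[C] (1 : S j) = 1 ⊗ₜ x j) :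
    x ⊗ₜ[C] (1 : ∀ i, S i) = 1 ⊗ₜ x := by
  have h1 : ∀ y : ∀ i, S i, y = ∑ i, LinearMap.single C S i (y i) := fun y ↦ by
    simp [Finset.univ_sum_single]
  conv_lhs => rw [h1 x, h1 1, TensorProduct.sum_tmul]
  conv_rhs => rw [h1 x, h1 1, TensorProduct.sum_tmul]
  refine Finset.sum_congr rfl fun i _ ↦ ?_
  rw [TensorProduct.tmul_sum, TensorProduct.tmul_sum]
  refine Finset.sum_congr rfl fun j _ ↦ ?_
  rw [← TensorProduct.map_tmul, ← TensorProduct.map_tmul, Pi.one_apply, Pi.one_apply, hx]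

theorem eq_zero_of_pi_one_tmul_eq_zero [DecidableEq ι] [Module.FaithfullyFlat C (∀ i, S i)] {M : Type*}
    [AddCommGroup M] [Module C M] (y : M) (hy : ∀ i, (1 : S i) ⊗ₜ[C] y = 0) : y = 0 := by
  refine (Module.FaithfullyFlat.one_tmul_eq_zero_iff (A := ∀ i, S i) C M y).1 ?_
  have h1 : (1 : ∀ i, S i) = ∑ i, LinearMap.single C S i 1 := by
    simp only [LinearMap.coe_single]
    exact (Finset.univ_sum_single (1 : ∀ i, S i)).symm
  rw [h1, TensorProduct.sum_tmul]
  refine Finset.sum_eq_zero fun i _ ↦ ?_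
  rw [← LinearMap.id_apply (R := C) y, ← TensorProduct.map_tmul, hy, map_zero]

end Pi

/-- One flat splitting ring per maximal ideal suffices, and semilocality makes their product finite,
hence faithfully flat. The degrees may differ between factors. -/
theorem IsAzumaya.existsUnique_isReducedNorm.{u, v} (C : Type u) (A : Type v) [CommRing C] [Ring A]
    [Algebra C A] [IsAzumaya C A] [Finite (MaximalSpectrum C)] :
    ∃! N : A →* C, IsReducedNorm C A N := by
  classical
  have := Fintype.ofFinite (MaximalSpectrum C)
  have H (m : MaximalSpectrum C) :=
    IsAzumaya.exists_flat_algEquiv_matrix C A m.asIdeal (hm := m.isMaximal)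
  choose S hS hS' n hflat hne hφ using H
  let φ (m : MaximalSpectrum C) := (hφ m).some
  have : Module.FaithfullyFlat C (∀ m, S m) :=
    Module.FaithfullyFlat.pi_of_map_ne_top S fun m hm ↦ ⟨⟨m, hm⟩, hne _⟩
  have hinj : Function.Injective (algebraMap C (∀ m, S m)) := FaithfulSMul.algebraMap_injective _ _
  have hdesc (a : A) : ∃ c, algebraMap C (∀ m, S m) c = fun m ↦ (φ m (1 ⊗ₜ a)).det :=
    Module.FaithfullyFlat.exists_algebraMap_eq_of_tmul_eq _ <|
      tmul_one_eq_one_tmul_of_pi S _ fun i j ↦ det_tmul_one_eq_one_tmul_det (φ i) (φ j) a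
  choose N hN using hdesc
  have hN' : ∀ a m, algebraMap C (S m) (N a) = (φ m (1 ⊗ₜ a)).det := fun a m ↦ congrFun (hN a) m
  refine ⟨{ toFun := N, map_one' := hinj ?_, map_mul' := fun a b ↦ hinj ?_ }, ?_, ?_⟩
  · rw [hN, map_one]
    funext m
    rw [← Algebra.TensorProduct.one_def, map_one, Matrix.det_one]
    rfl
  · rw [map_mul, hN, hN, hN]
    funext m
    rw [Pi.mul_apply, ← Matrix.det_mul, ← map_mul, Algebra.TensorProduct.tmul_mul_tmul, one_mul]
  · intro S' _ _ n' ψ a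
    change algebraMap C S' (N a) = _
    rw [← sub_eq_zero]
    refine eq_zero_of_pi_one_tmul_eq_zero (C := C) S _ fun m ↦ ?_
    rw [TensorProduct.tmul_sub, ← det_tmul_one_eq_one_tmul_det (φ m) ψ a, ← hN',
      Algebra.algebraMap_eq_smul_one, Algebra.algebraMap_eq_smul_one, TensorProduct.smul_tmul,
      sub_self]
  · intro N' hN₂
    ext a
    refine hinj ?_
    change _ = algebraMap C (∀ m, S m) (N a)
    rw [hN]
    funext m
    exact hN₂ (S m) (n m) (φ m) a

/-! ### Compatibility of the reduced norm with the involution -/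

section Twist

variable {C A S S' : Type*} [CommRing C] [Ring A] [Algebra C A] [CommRing S] [Algebra C S]
  [CommRing S'] [Algebra C S']

/-- The anti-homomorphism `s ⊗ a ↦ ε s ⊗ σ a` when `ε` and `σ` are semilinear with respect to the
same endomorphism of the base ring. -/
noncomputable def twistTensor (τ : C →+* C) (σ : A →+ A) (hσ : ∀ (c : C) a, σ (c • a) = τ c • σ a)
    (ε : S' →+* S) (hε : ∀ c, ε (algebraMap C S' c) = algebraMap C S (τ c)) :
    S' ⊗[C] A →+ S ⊗[C] A :=
  TensorProduct.liftAddHom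
    { toFun := fun s ↦ (TensorProduct.mk C S A (ε s)).toAddMonoidHom.comp σ
      map_zero' := by ext; simp
      map_add' := fun x y ↦ by ext; simp } <| by
    intro c s a
    simp only [AddMonoidHom.coe_mk, ZeroHom.coe_mk, AddMonoidHom.comp_apply,
      LinearMap.toAddMonoidHom_coe, TensorProduct.mk_apply]
    rw [hσ, Algebra.smul_def, map_mul, hε, ← Algebra.smul_def, TensorProduct.smul_tmul]

/-- Transposition turns the anti-isomorphism s ⊗ a ↦ ε s ⊗ σ a, followed by φ, into a genuine
splitting, without changing determinants. -/
theorem exists_algEquiv_matrix_twist (τ : C →+* C) (hτ : ∀ c, τ (τ c) = c) (σ : A →+ A)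
    (hσσ : ∀ a, σ (σ a) = a) (hσm : ∀ a b, σ (a * b) = σ b * σ a)
    (hσ : ∀ (c : C) a, σ (c • a) = τ c • σ a)
    (ε : S' ≃+* S) (hε : ∀ c, ε (algebraMap C S' c) = algebraMap C S (τ c)) {n : ℕ}
    (φ : S ⊗[C] A ≃ₐ[S] Matrix (Fin n) (Fin n) S) :
    ∃ ψ : S' ⊗[C] A ≃ₐ[S'] Matrix (Fin n) (Fin n) S',
      ∀ a, ε (ψ (1 ⊗ₜ a)).det = (φ (1 ⊗ₜ σ a)).det := by
  have hε' : ∀ c, (ε.symm : S →+* S') (algebraMap C S c) = algebraMap C S' (τ c) := fun c ↦ by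
    change ε.symm _ = _
    rw [RingEquiv.symm_apply_eq, hε, hτ]
  let F := twistTensor τ σ hσ (ε : S' →+* S) hε
  let G := twistTensor τ σ hσ (ε.symm : S →+* S') hε'
  have hF : ∀ s a, F (s ⊗ₜ a) = ε s ⊗ₜ σ a := fun s a ↦ rfl
  have hG : ∀ s a, G (s ⊗ₜ a) = ε.symm s ⊗ₜ σ a := fun s a ↦ rfl
  have hGF : ∀ z, G (F z) = z := fun z ↦ by
    induction z with
    | zero => simp
    | add x y hx hy => rw [map_add, map_add, hx, hy]
    | tmul s a => rw [hF, hG, RingEquiv.symm_apply_apply, hσσ]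
  have hFG : ∀ z, F (G z) = z := fun z ↦ by
    induction z with
    | zero => simp
    | add x y hx hy => rw [map_add, map_add, hx, hy]
    | tmul s a => rw [hG, hF, RingEquiv.apply_symm_apply, hσσ]
  have hFmul : ∀ y z, F (y * z) = F z * F y := fun y z ↦ by
    induction y with
    | zero => simp
    | add x y hx hy => rw [add_mul, map_add, map_add, mul_add, hx, hy]
    | tmul s a =>
      induction z with
      | zero => simp
      | add x y hx hy => rw [mul_add, map_add, map_add, add_mul, hx, hy]
      | tmul t b =>
        rw [Algebra.TensorProduct.tmul_mul_tmul, hF, hF, hF, Algebra.TensorProduct.tmul_mul_tmul,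
          hσm, map_mul, mul_comm]
  let E : S' ⊗[C] A ≃+* Matrix (Fin n) (Fin n) S' :=
    { toFun := fun z ↦ ((φ (F z)).map ε.symm).transpose
      invFun := fun M ↦ G (φ.symm (M.transpose.map ε))
      left_inv := fun z ↦ by
        have : ((((φ (F z)).map ε.symm).transpose).transpose.map ε) = φ (F z) := by
          ext; simp
        change G (φ.symm _) = z
        rw [this, AlgEquiv.symm_apply_apply, hGF]
      right_inv := fun M ↦ by
        change ((φ (F (G _))).map ε.symm).transpose = M
        rw [hFG, AlgEquiv.apply_symm_apply]
        ext; simp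
      map_mul' := fun y z ↦ by
        rw [hFmul, map_mul]
        have : (φ (F z) * φ (F y)).map ε.symm = (φ (F z)).map ε.symm * (φ (F y)).map ε.symm :=
          map_mul ε.symm.mapMatrix _ _
        rw [this, Matrix.transpose_mul]
      map_add' := fun y z ↦ by
        ext; simp }
  refine ⟨AlgEquiv.ofRingEquiv (f := E) fun s ↦ ?_, fun a ↦ ?_⟩
  · change ((φ (F (s ⊗ₜ 1))).map ε.symm).transpose = _
    have h1 : σ 1 = 1 := by
      have h := hσm (σ 1) 1
      rw [mul_one, hσσ, mul_one] at h
      exact h.symm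
    rw [hF, h1]
    have : φ (ε s ⊗ₜ 1) = algebraMap S _ (ε s) := φ.commutes (ε s)
    rw [this]
    ext i j
    by_cases h : i = j
    · subst h; simp [Matrix.algebraMap_matrix_apply]
    · simp [Matrix.algebraMap_matrix_apply, h, Ne.symm h]
  · change ε ((φ (F (1 ⊗ₜ a))).map ε.symm).transpose.det = _
    rw [Matrix.det_transpose, hF, map_one]
    have := RingEquiv.map_det ε.symm (φ (1 ⊗ₜ σ a))
    rw [RingEquiv.mapMatrix_apply] at this
    rw [← this, RingEquiv.apply_symm_apply]

end Twist

/-- The map a ↦ τ(N(σ a)) is again a reduced norm, so uniqueness identifies it with N. -/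
theorem IsReducedNorm.apply_involution.{u, v} {C : Type u} {A : Type v} [CommRing C] [Ring A]
    [Algebra C A] (hex : ∃! N : A →* C, IsReducedNorm C A N) {N : A →* C} (hN : IsReducedNorm C A N)
    (τ : C →+* C) (hτ : ∀ c, τ (τ c) = c) (σ : A →+ A)
    (hσσ : ∀ a, σ (σ a) = a) (hσm : ∀ a b, σ (a * b) = σ b * σ a)
    (hσ : ∀ (c : C) a, σ (c • a) = τ c • σ a) (a : A) : N (σ a) = τ (N a) := by
  have h1 : σ 1 = 1 := by
    have h := hσm (σ 1) 1
    rw [mul_one, hσσ, mul_one] at h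
    exact h.symm
  let N' : A →* C :=
    { toFun := fun a ↦ τ (N (σ a))
      map_one' := by rw [h1, map_one, map_one]
      map_mul' := fun a b ↦ by rw [hσm, map_mul, map_mul, mul_comm] }
  have hN' : IsReducedNorm C A N' := by
    intro S _ i n φ a
    -- The same ring S with its C-structure twisted by τ; N is evaluated on the splitting over this
    -- algebra.
    let i' : Algebra C S := ((algebraMap C S).comp τ).toAlgebra
    obtain ⟨ψ, hψ⟩ := @exists_algEquiv_matrix_twist C A S S _ _ _ _ i _ i' τ hτ σ hσσ hσm hσ
      (RingEquiv.refl S) (fun c ↦ rfl) n φ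
    have h2 := @hN S _ i' n ψ (σ a)
    have h3 := hψ (σ a)
    rw [hσσ] at h3
    exact h2.trans h3
  have h := congrArg (fun M : A →* C ↦ τ (M a)) (hex.unique hN' hN)
  simpa [N', hτ] using h

/-! ### Finiteness of bad parameters on a line -/

section Generic

variable {k V ι : Type*} [Field k] [Ring V] [Algebra k V] [Fintype ι] [DecidableEq ι]

theorem Matrix.finite_setOf_det_map_eval_eq_zero (M : Matrix ι ι (Polynomial k)) (t₀ : k)
    (h : (M.map (Polynomial.eval t₀)).det ≠ 0) :
    {t | (M.map (Polynomial.eval t)).det = 0}.Finite := by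
  have hdet : ∀ t, (M.map (Polynomial.eval t)).det = M.det.eval t := fun t ↦
    ((Polynomial.evalRingHom t).map_det M).symm
  have h0 : M.det ≠ 0 := fun h0 ↦ h (by rw [hdet, h0, Polynomial.eval_zero])
  refine (M.det.rootSet_finite k).subset fun t ht ↦ ?_
  rw [Polynomial.mem_rootSet]
  refine ⟨h0, ?_⟩
  rw [Polynomial.coe_aeval_eq_eval, ← hdet]
  exact ht

theorem isUnit_of_bijective_mulLeft {R A : Type*} [CommRing R] [Ring A] [Algebra R A] {x : A}
    (h : Function.Bijective (LinearMap.mulLeft R x)) : IsUnit x := by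
  obtain ⟨y, hy⟩ := h.2 1
  have hxy : x * y = 1 := hy
  have hyx : y * x = 1 := h.1 (by
    change x * (y * x) = x * 1
    rw [← mul_assoc, hxy, one_mul, mul_one])
  exact ⟨⟨x, y, hxy, hyx⟩, rfl⟩

theorem isUnit_iff_det_leftMulMatrix_ne_zero (b : Module.Basis ι k V) (x : V) :
    IsUnit x ↔ (Algebra.leftMulMatrix b x).det ≠ 0 := by
  constructor
  · intro h
    exact ((Matrix.isUnit_iff_isUnit_det _).1 (h.map (Algebra.leftMulMatrix b))).ne_zero
  · intro h
    refine isUnit_of_bijective_mulLeft (R := k) ?_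
    have h1 : IsUnit (LinearMap.toMatrix b b (LinearMap.mulLeft k x)).det := isUnit_iff_ne_zero.2 h
    rw [← LinearEquiv.coe_ofIsUnitDet h1]
    exact (LinearEquiv.ofIsUnitDet h1).bijective

theorem finite_setOf_not_isUnit_add_smul [FiniteDimensional k V] (x y : V) (t₀ : k)
    (h : IsUnit (x + t₀ • y)) : {t : k | ¬ IsUnit (x + t • y)}.Finite := by
  let b := Module.finBasis k V
  let M : Matrix _ _ (Polynomial k) := (Algebra.leftMulMatrix b x).map Polynomial.C +
    (Polynomial.X : Polynomial k) • (Algebra.leftMulMatrix b y).map Polynomial.C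
  have hM : ∀ t, M.map (Polynomial.eval t) = Algebra.leftMulMatrix b (x + t • y) := fun t ↦ by
    ext i j
    simp [M]
    exact mul_comm _ _
  refine (M.finite_setOf_det_map_eval_eq_zero t₀ ?_).subset fun t ht ↦ ?_
  · rw [hM]
    exact (isUnit_iff_det_leftMulMatrix_ne_zero b _).1 h
  · by_contra h'
    exact ht ((isUnit_iff_det_leftMulMatrix_ne_zero b _).2 (by rw [← hM]; exact h'))

/-- By Cramer's rule the solution, cleared of its denominator, is polynomial in t, so its
invertibility is also the nonvanishing of a polynomial. -/
theorem finite_setOf_not_exists_isUnit_apply_eq [FiniteDimensional k V] (f g : Module.End k V)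
    (v : V) (t₀ : k) (hbij : Function.Bijective (f + t₀ • g))
    (hv : ∃ w, IsUnit w ∧ (f + t₀ • g) w = v) :
    {t : k | ¬ (Function.Bijective (f + t • g) ∧ ∃ w, IsUnit w ∧ (f + t • g) w = v)}.Finite := by
  let b := Module.finBasis k V
  let M : Matrix _ _ (Polynomial k) := (LinearMap.toMatrix b b f).map Polynomial.C +
    (Polynomial.X : Polynomial k) • (LinearMap.toMatrix b b g).map Polynomial.C
  have hM : ∀ t, M.map (Polynomial.eval t) = LinearMap.toMatrix b b (f + t • g) := fun t ↦ by
    ext i j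
    simp [M]
    exact mul_comm _ _
  have hdet : ∀ t, (M.map (Polynomial.eval t)).det = M.det.eval t := fun t ↦
    ((Polynomial.evalRingHom t).map_det M).symm
  -- The vector w t built from the adjugate solves the equation with right side det(M)(t) • v, for
  -- every t including the singular ones.
  let c := M.adjugate.mulVec fun i ↦ Polynomial.C (b.repr v i)
  let w (t : k) : V := ∑ i, (c i).eval t • b i
  have hrepr : ∀ t, ⇑(b.repr (w t)) = fun i ↦ (c i).eval t := fun t ↦ by
    ext i
    simp [w, Finsupp.single_apply]
  have hw : ∀ t, (f + t • g) (w t) = M.det.eval t • v := fun t ↦ by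
    apply b.repr.injective
    ext i
    rw [← LinearMap.toMatrix_mulVec_repr b b, hrepr, ← hM]
    have h1 : M.mulVec c = M.det • fun i ↦ Polynomial.C (b.repr v i) := by
      rw [Matrix.mulVec_mulVec, Matrix.mul_adjugate, Matrix.smul_mulVec, Matrix.one_mulVec]
    have h2 := congrArg (Polynomial.evalRingHom t) (congrFun h1 i)
    rw [RingHom.map_mulVec] at h2
    simpa [Function.comp_def] using h2
  let G : Matrix _ _ (Polynomial k) := ∑ i, c i • (Algebra.leftMulMatrix b (b i)).map Polynomial.C
  have hG : ∀ t, G.map (Polynomial.eval t) = Algebra.leftMulMatrix b (w t) := fun t ↦ by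
    ext i j
    simp [G, w, Matrix.sum_apply, Polynomial.eval_finsetSum]
  have hdet₀ : M.det.eval t₀ ≠ 0 := by
    rw [← hdet, hM]
    exact ((LinearEquiv.ofBijective _ hbij).isUnit_det b b).ne_zero
  refine ((M.finite_setOf_det_map_eval_eq_zero t₀ ?_).union
    (G.finite_setOf_det_map_eval_eq_zero t₀ ?_)).subset fun t ht ↦ ?_
  · rwa [hdet]
  · rw [hG, ← isUnit_iff_det_leftMulMatrix_ne_zero]
    obtain ⟨w₀, hw₀, hw₀v⟩ := hv
    have h1 : w t₀ = M.det.eval t₀ • w₀ := hbij.1 (by rw [hw, map_smul, hw₀v])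
    rw [h1, Algebra.smul_def]
    exact ((isUnit_iff_ne_zero.2 hdet₀).map (algebraMap k V)).mul hw₀
  · by_contra h'
    simp only [Set.mem_union, Set.mem_ofPred_eq, not_or] at h'
    obtain ⟨h1, h2⟩ := h'
    rw [hG, ← ne_eq, ← isUnit_iff_det_leftMulMatrix_ne_zero] at h2
    refine ht ⟨?_, (M.det.eval t)⁻¹ • w t, ?_, ?_⟩
    · rw [hM] at h1
      rw [← LinearEquiv.coe_ofIsUnitDet (isUnit_iff_ne_zero.2 h1)]
      exact (LinearEquiv.ofIsUnitDet _).bijective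
    · rw [Algebra.smul_def]
      refine IsUnit.mul ((isUnit_iff_ne_zero.2 (inv_ne_zero ?_)).map (algebraMap k V)) h2
      rwa [← hdet]
    · rw [map_smul, hw, smul_smul, inv_mul_cancel₀, one_smul]
      rwa [← hdet]

end Generic

/-! ### Sylvester operators and Cayley elements over a field -/

section Sylvester

/-- The operator `h ↦ b * h - h * s b`, as a linear function of `b`. -/
def sylvester {R A : Type*} [CommRing R] [Ring A] [Algebra R A] (s : A →ₗ[R] A) :
    A →ₗ[R] Module.End R A :=
  LinearMap.mul R A - (LinearMap.mul R A).flip ∘ₗ s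

@[simp]
theorem sylvester_apply {R A : Type*} [CommRing R] [Ring A] [Algebra R A] (s : A →ₗ[R] A)
    (b h : A) : sylvester s b h = b * h - h * s b := rfl

/-- The element `b` is invertible, its Sylvester operator is bijective, and the solution `h` of
`b * h - h * s b = 2 * d` is invertible. -/
def IsSylvesterRegular {R A : Type*} [CommRing R] [Ring A] [Algebra R A] (s : A →ₗ[R] A)
    (d b : A) : Prop :=
  IsUnit b ∧ Function.Bijective (sylvester s b) ∧ ∃ h, IsUnit h ∧ sylvester s b h = 2 * d

/-- The element d is itself regular: its Sylvester operator is multiplication by the unit 2d, and h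
= 1 is the solution. Any line through d therefore has only finitely many irregular points. -/
theorem finite_setOf_not_isSylvesterRegular {k V : Type*} [Field k] [Ring V] [Algebra k V]
    [FiniteDimensional k V] (h2 : (2 : k) ≠ 0) (s : V →ₗ[k] V) (d : V) (hd : IsUnit d)
    (hcomm : ∀ x, d * x = x * d) (hs : s d = -d) (p q : V) (t₀ : k) (hpq : p + t₀ • q = d) :
    {t : k | ¬ IsSylvesterRegular s d (p + t • q)}.Finite := by
  have hL : ∀ h, sylvester s d h = (2 * d) * h := fun h ↦ by
    rw [sylvester_apply, hs, mul_neg, sub_neg_eq_add, ← hcomm, two_mul, add_mul]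
  have h2d : IsUnit (2 * d) := by
    have : (2 : V) = algebraMap k V 2 := by rw [map_ofNat]
    rw [this]
    exact ((isUnit_iff_ne_zero.2 h2).map (algebraMap k V)).mul hd
  have hadd : ∀ t : k, sylvester s (p + t • q) = sylvester s p + t • sylvester s q := fun t ↦ by
    rw [map_add, map_smul]
  have hbij : Function.Bijective (sylvester s d) := by
    obtain ⟨u, hu⟩ := h2d
    have : ⇑(sylvester s d) = fun h ↦ (u : V) * h := by
      funext h
      rw [hL, hu]
    rw [this]
    exact u.mulLeft_bijective
  refine ((finite_setOf_not_isUnit_add_smul p q t₀ (by rwa [hpq])).union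
    (finite_setOf_not_exists_isUnit_apply_eq (sylvester s p) (sylvester s q) (2 * d) t₀ ?_ ?_)).subset
      fun t ht ↦ ?_
  · rwa [← hadd, hpq]
  · exact ⟨1, isUnit_one, by rw [← hadd, hpq, hL, mul_one]⟩
  · by_contra h'
    simp only [Set.mem_union, Set.mem_ofPred_eq, not_or, not_not] at h'
    refine ht ⟨h'.1, ?_⟩
    rw [hadd]
    exact h'.2

/-- Multiplying by the conjugate with -t gives (1+u)² - t²δ(1-u)², a line in the parameter t². At t²
= δ⁻¹ it equals 4u, a unit, even though δ need not be a square. -/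
theorem finite_setOf_not_isUnit_cayley {k V : Type*} [Field k] [Ring V] [Algebra k V]
    [FiniteDimensional k V] (h2 : (2 : k) ≠ 0) (d u : V) (δ : k) (hδ : δ ≠ 0)
    (hd : d * d = algebraMap k V δ) (hcomm : ∀ x, d * x = x * d) (hu : IsUnit u) :
    {t : k | ¬ IsUnit (1 + u + t • (d * (1 - u)))}.Finite := by
  have h4 : IsUnit ((1 + u) * (1 + u) + δ⁻¹ • -(algebraMap k V δ * ((1 - u) * (1 - u)))) := by
    have h1 : (1 + u) * (1 + u) + δ⁻¹ • -(algebraMap k V δ * ((1 - u) * (1 - u))) =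
        algebraMap k V (2 * 2) * u := by
      rw [smul_neg, ← Algebra.smul_def, smul_smul, inv_mul_cancel₀ hδ, one_smul, map_mul, map_ofNat]
      noncomm_ring
    rw [h1]
    exact ((isUnit_iff_ne_zero.2 (mul_ne_zero h2 h2)).map (algebraMap k V)).mul hu
  have hfin := finite_setOf_not_isUnit_add_smul _ _ _ h4
  have hpre : ((fun t : k ↦ t * t) ⁻¹'
      {t | ¬ IsUnit ((1 + u) * (1 + u) + t • -(algebraMap k V δ * ((1 - u) * (1 - u))))}).Finite := by
    refine hfin.preimage' fun y _ ↦ ?_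
    have hne : (Polynomial.X ^ 2 - Polynomial.C y : Polynomial k) ≠ 0 :=
      Polynomial.X_pow_sub_C_ne_zero two_pos y
    refine (Polynomial.rootSet_finite (Polynomial.X ^ 2 - Polynomial.C y) k).subset fun t ht ↦ ?_
    rw [Polynomial.mem_rootSet]
    refine ⟨hne, ?_⟩
    have : t * t = y := ht
    simp [pow_two, this]
  refine hpre.subset fun t ht h' ↦ ht ?_
  have hdu : d * (1 - u) * (1 + u) = (1 + u) * (d * (1 - u)) := by
    rw [mul_assoc, hcomm, hcomm (1 - u)]
    noncomm_ring
  have hdd : d * (1 - u) * (d * (1 - u)) = algebraMap k V δ * ((1 - u) * (1 - u)) := by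
    rw [← hd, mul_assoc, ← mul_assoc (1 - u), ← hcomm (1 - u)]
    simp only [mul_assoc]
  have hcom₁ : Commute (1 + u) (t • (d * (1 - u))) := by
    rw [Commute, SemiconjBy, mul_smul_comm, smul_mul_assoc, hdu]
  have hprod : (1 + u + t • (d * (1 - u))) * (1 + u - t • (d * (1 - u))) =
      (1 + u) * (1 + u) + (t * t) • -(algebraMap k V δ * ((1 - u) * (1 - u))) := by
    rw [← hcom₁.mul_self_sub_mul_self_eq, smul_mul_smul_comm, hdd, smul_neg, sub_eq_add_neg]
  have hcom : Commute (1 + u + t • (d * (1 - u))) (1 + u - t • (d * (1 - u))) :=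
    ((Commute.refl _).sub_right hcom₁).add_left (hcom₁.symm.sub_right (Commute.refl _))
  rw [← hprod] at h'
  exact (hcom.isUnit_mul_iff.1 h').1

end Sylvester

/-! ### Passing from residue fields to the semilocal ring -/

section Semilocal

variable {R : Type*} [CommRing R]

theorem LinearMap.surjective_of_forall_baseChange_quotient_surjective {M N : Type*}
    [AddCommGroup M] [Module R M] [AddCommGroup N] [Module R N] [Module.Finite R N] (f : M →ₗ[R] N)
    (h : ∀ m : Ideal R, m.IsMaximal → Function.Surjective (f.baseChange (R ⧸ m))) :
    Function.Surjective f := by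
  rw [← LinearMap.range_eq_top]
  by_contra hne
  let Q := N ⧸ LinearMap.range f
  have hann : Module.annihilator R Q ≠ ⊤ := by
    rw [ne_eq, Module.annihilator_eq_top_iff]
    exact not_subsingleton_iff_nontrivial.2 (Submodule.Quotient.nontrivial_iff.2 hne)
  obtain ⟨m, hm, hle⟩ := Ideal.exists_le_maximal _ hann
  have hzero : ∀ z : (R ⧸ m) ⊗[R] Q, z = 0 := by
    intro z
    have hsurj : Function.Surjective ((LinearMap.range f).mkQ.baseChange (R ⧸ m)) :=
      LinearMap.lTensor_surjective _ (Submodule.mkQ_surjective _)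
    obtain ⟨y, rfl⟩ := hsurj z
    obtain ⟨x, rfl⟩ := h m hm y
    rw [← LinearMap.comp_apply, ← LinearMap.baseChange_comp, LinearMap.range_mkQ_comp]
    simp
  -- The cokernel Q vanishes modulo m, so Nakayama gives r ≡ 1 mod m killing Q; but the annihilator
  -- of Q lies in m.
  have htop : (⊤ : Submodule R Q) ≤ m • ⊤ := by
    intro q _
    have := (TensorProduct.quotTensorEquivQuotSMul Q m).symm.injective.eq_iff.1
      ((hzero ((TensorProduct.quotTensorEquivQuotSMul Q m).symm (Submodule.Quotient.mk q))).trans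
        (map_zero (TensorProduct.quotTensorEquivQuotSMul Q m).symm).symm)
    rwa [Submodule.Quotient.mk_eq_zero] at this
  obtain ⟨r, hr, hr0⟩ := Submodule.exists_sub_one_mem_and_smul_eq_zero_of_fg_of_le_smul m ⊤
    Module.Finite.fg_top htop
  have hrm : r ∈ m := hle (Module.mem_annihilator.2 fun q ↦ hr0 q trivial)
  exact hm.ne_top ((Ideal.eq_top_iff_one m).2 (by simpa using m.sub_mem hrm hr))

theorem LinearMap.bijective_of_forall_baseChange_quotient_surjective {M : Type*}
    [AddCommGroup M] [Module R M] [Module.Finite R M] (f : M →ₗ[R] M)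
    (h : ∀ m : Ideal R, m.IsMaximal → Function.Surjective (f.baseChange (R ⧸ m))) :
    Function.Bijective f :=
  have hf := f.surjective_of_forall_baseChange_quotient_surjective h
  ⟨OrzechProperty.injective_of_surjective_endomorphism f hf, hf⟩

theorem isUnit_of_forall_isUnit_quotient_tmul {A : Type*} [Ring A] [Algebra R A] [Module.Finite R A]
    (x : A) (h : ∀ m : Ideal R, m.IsMaximal → IsUnit ((1 : R ⧸ m) ⊗ₜ[R] x)) : IsUnit x := by
  refine isUnit_of_bijective_mulLeft (R := R)
    (LinearMap.bijective_of_forall_baseChange_quotient_surjective _ fun m hm ↦ ?_)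
  obtain ⟨u, hu⟩ := h m hm
  have : (LinearMap.mulLeft R x).baseChange (R ⧸ m) = LinearMap.mulLeft (R ⧸ m) (1 ⊗ₜ x) := by
    ext; simp
  rw [this, ← hu]
  exact u.mulLeft_bijective.2

theorem exists_forall_mk_notMem_of_finite [Finite (MaximalSpectrum R)]
    (hinf : ∀ m : Ideal R, m.IsMaximal → Infinite (R ⧸ m)) (B : ∀ m : Ideal R, Set (R ⧸ m))
    (hB : ∀ m : Ideal R, m.IsMaximal → (B m).Finite) :
    ∃ t : R, ∀ m : Ideal R, m.IsMaximal → Ideal.Quotient.mk m t ∉ B m := by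
  have hx : ∀ m : MaximalSpectrum R, ∃ x : R, Ideal.Quotient.mk m.asIdeal x ∉ B m.asIdeal := by
    intro m
    have := hinf _ m.isMaximal
    obtain ⟨y, hy⟩ := (hB _ m.isMaximal).exists_notMem
    obtain ⟨x, rfl⟩ := Ideal.Quotient.mk_surjective y
    exact ⟨x, hy⟩
  choose x hx using hx
  obtain ⟨t, ht⟩ := Ideal.exists_forall_sub_mem_ideal (I := fun m : MaximalSpectrum R ↦ m.asIdeal)
    (fun m m' hne ↦ Ideal.isCoprime_of_isMaximal fun h ↦ hne (MaximalSpectrum.ext h)) x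
  refine ⟨t, fun m hm ↦ ?_⟩
  rw [Ideal.Quotient.eq.2 (ht ⟨m, hm⟩)]
  exact hx ⟨m, hm⟩

theorem finite_maximalSpectrum_of_finite [Finite (MaximalSpectrum R)] (C : Type*) [CommRing C]
    [Algebra R C] [Module.Finite R C] : Finite (MaximalSpectrum C) := by
  let f : MaximalSpectrum C → MaximalSpectrum R := fun m ↦
    have := m.isMaximal
    ⟨m.asIdeal.comap (algebraMap R C), Ideal.isMaximal_comap_of_isIntegral_of_isMaximal _⟩
  rw [← Set.finite_univ_iff]
  refine Set.Finite.of_finite_fibers f (Set.toFinite _) fun p _ ↦ ?_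
  have hfin := Algebra.QuasiFinite.finite_primesOver (S := C) p.asIdeal
  refine Set.Finite.of_finite_image (f := MaximalSpectrum.asIdeal) (hfin.subset ?_)
    (fun m _ m' _ h ↦ MaximalSpectrum.ext h)
  rintro _ ⟨m, ⟨-, rfl⟩, rfl⟩
  exact ⟨m.isMaximal.isPrime, ⟨rfl⟩⟩

theorem isUnit_of_forall_notMem_maximal {x : R} (h : ∀ m : Ideal R, m.IsMaximal → x ∉ m) :
    IsUnit x := by
  by_contra hx
  obtain ⟨m, hm, hxm⟩ := exists_max_ideal_of_mem_nonunits hx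
  exact h m hm hxm

theorem two_ne_zero_of_ringChar_ne_two {m : Ideal R} (hm : m.IsMaximal)
    (h : ringChar (R ⧸ m) ≠ 2) : (2 : R ⧸ m) ≠ 0 := by
  let _ := Ideal.Quotient.field m
  exact Ring.two_ne_zero h

end Semilocal

/-! ### A skew central element with invertible square -/

section SkewUnit

variable {R C : Type*} [CommRing R] [CommRing C] [Algebra R C]

theorem Module.finrank_quotient_tensorProduct_eq_rankAtStalk {M : Type*} [AddCommGroup M]
    [Module R M] [Module.Finite R M] [Module.Flat R M] (m : Ideal R) [hm : m.IsMaximal] :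
    Module.finrank (R ⧸ m) ((R ⧸ m) ⊗[R] M) = Module.rankAtStalk (R := R) M ⟨m, hm.isPrime⟩ := by
  let _ := Ideal.Quotient.field m
  have h1 := Module.rankAtStalk_baseChange (R := R) (M := M) (S := R ⧸ m) ⊥
  rw [Module.rankAtStalk_eq_finrank_of_free] at h1
  have h3 : PrimeSpectrum.comap (algebraMap R (R ⧸ m)) ⊥ = ⟨m, hm.isPrime⟩ := by
    ext x
    simp [Ideal.Quotient.eq_zero_iff_mem]
  rw [h3] at h1
  exact h1

theorem exists_skew_mul_self_notMem [Module.Finite R C] [Module.Flat R C]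
    [Algebra.FormallyUnramified R C] [Algebra.EssFiniteType R C]
    (τ : C →ₗ[R] C) (hτm : ∀ x y, τ (x * y) = τ x * τ y) (hττ : ∀ x, τ (τ x) = x)
    (hfix : ∀ c, τ c = c → c ∈ (algebraMap R C).range) (h2 : IsUnit (2 : R))
    (m : Ideal R) (hm : m.IsMaximal)
    (hrank : Module.rankAtStalk (R := R) C ⟨m, hm.isPrime⟩ = 2) :
    ∃ (c : C) (r : R), τ c = -c ∧ c * c = algebraMap R C r ∧ r ∉ m := by
  let _ := Ideal.Quotient.field m
  obtain ⟨i2, hi2⟩ := h2.exists_left_inv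
  have hfinrank : Module.finrank (R ⧸ m) ((R ⧸ m) ⊗[R] C) = 2 := by
    rw [Module.finrank_quotient_tensorProduct_eq_rankAtStalk, hrank]
  have hred : IsReduced ((R ⧸ m) ⊗[R] C) :=
    Algebra.FormallyUnramified.isReduced_of_field (R ⧸ m) _
  -- As 2 is invertible, C is R plus its skew part. If all skew elements died in the fibre, it would
  -- be spanned by 1, against rank two.
  obtain ⟨c, hc, hc0⟩ : ∃ c : C, τ c = -c ∧ (1 : R ⧸ m) ⊗ₜ[R] c ≠ 0 := by
    by_contra! h
    have hspan : ∀ z : (R ⧸ m) ⊗[R] C, ∃ k : R ⧸ m, k • (1 : (R ⧸ m) ⊗[R] C) = z := by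
      intro z
      induction z with
      | zero => exact ⟨0, zero_smul _ _⟩
      | add x y hx hy =>
        obtain ⟨a, rfl⟩ := hx
        obtain ⟨b, rfl⟩ := hy
        exact ⟨a + b, add_smul _ _ _⟩
      | tmul k c =>
        obtain ⟨r, hr⟩ := hfix (i2 • (c + τ c)) (by rw [map_smul, map_add, hττ, add_comm])
        have hskew := h (i2 • (c - τ c)) (by rw [map_smul, map_sub, hττ, ← smul_neg, neg_sub])
        have hc : c = r • (1 : C) + i2 • (c - τ c) := by
          rw [← Algebra.algebraMap_eq_smul_one, hr, ← smul_add, add_add_sub_cancel, ← two_smul R c,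
            smul_smul, hi2, one_smul]
        refine ⟨k * algebraMap R (R ⧸ m) r, ?_⟩
        have h1 : (k ⊗ₜ[R] c : (R ⧸ m) ⊗[R] C) = k • (1 ⊗ₜ c) := by
          rw [TensorProduct.smul_tmul', smul_eq_mul, mul_one]
        rw [h1, hc, TensorProduct.tmul_add, hskew, add_zero, TensorProduct.tmul_smul, mul_smul,
          algebraMap_smul]
        rfl
    have := finrank_le_one (1 : (R ⧸ m) ⊗[R] C) hspan
    omega
  obtain ⟨r, hr⟩ := hfix (c * c) (by rw [hτm, hc, neg_mul_neg])
  refine ⟨c, r, hc, hr.symm, fun hrm ↦ hc0 ?_⟩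
  -- The fibre of an unramified algebra is reduced, so a nonzero element cannot have square zero.
  have hsq : ((1 : R ⧸ m) ⊗ₜ[R] c) ^ 2 = 0 := by
    rw [pow_two, Algebra.TensorProduct.tmul_mul_tmul, mul_one, ← hr,
      Algebra.algebraMap_eq_smul_one, ← TensorProduct.smul_tmul, Algebra.smul_def,
      Ideal.Quotient.algebraMap_eq, Ideal.Quotient.eq_zero_iff_mem.2 hrm, zero_mul,
      TensorProduct.zero_tmul]
  exact pow_eq_zero_iff two_ne_zero |>.1 hsq

theorem exists_skew_mul_self_isUnit [Finite (MaximalSpectrum R)] [Module.Finite R C]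
    [Module.Flat R C] [Algebra.FormallyUnramified R C] [Algebra.EssFiniteType R C]
    (τ : C →ₗ[R] C) (hτm : ∀ x y, τ (x * y) = τ x * τ y) (hττ : ∀ x, τ (τ x) = x)
    (hfix : ∀ c, τ c = c → c ∈ (algebraMap R C).range) (h2 : IsUnit (2 : R))
    (hrank : ∀ p : PrimeSpectrum R, Module.rankAtStalk (R := R) C p = 2) :
    ∃ (d : C) (δ : R), τ d = -d ∧ d * d = algebraMap R C δ ∧ IsUnit δ := by
  classical
  have := Fintype.ofFinite (MaximalSpectrum R)
  choose c r hc hcr hr using fun m : MaximalSpectrum R ↦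
    exists_skew_mul_self_notMem τ hτm hττ hfix h2 m.asIdeal m.isMaximal (hrank _)
  have hcop : Pairwise (Function.onFun IsCoprime fun m : MaximalSpectrum R ↦ m.asIdeal) :=
    fun m m' hne ↦ Ideal.isCoprime_of_isMaximal fun h ↦ hne (MaximalSpectrum.ext h)
  -- Chinese remainder coefficients, congruent to 1 at one maximal ideal and 0 at the others, glue
  -- the local choices while preserving skewness.
  choose e he using fun m : MaximalSpectrum R ↦
    Ideal.exists_forall_sub_mem_ideal hcop (Pi.single m (1 : R))
  let d := ∑ m, e m • c m
  have hd : τ d = -d := by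
    simp only [d, map_sum, map_smul, hc, smul_neg, Finset.sum_neg_distrib]
  obtain ⟨δ, hδ⟩ := hfix (d * d) (by rw [hτm, hd, neg_mul_neg])
  refine ⟨d, δ, hd, hδ.symm, isUnit_of_forall_notMem_maximal fun m hm hδm ↦ ?_⟩
  let m' : MaximalSpectrum R := ⟨m, hm⟩
  let _ := Ideal.Quotient.field m
  have htmul : ∀ r : R, (1 : R ⧸ m) ⊗ₜ[R] algebraMap R C r =
      algebraMap (R ⧸ m) _ (Ideal.Quotient.mk m r) := fun r ↦ by
    rw [Algebra.algebraMap_eq_smul_one, ← TensorProduct.smul_tmul, Algebra.smul_def, mul_one]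
    rfl
  have hdc : (1 : R ⧸ m) ⊗ₜ[R] d = 1 ⊗ₜ c m' := by
    rw [TensorProduct.tmul_sum, Finset.sum_eq_single m']
    · rw [TensorProduct.tmul_smul, ← algebraMap_smul (R ⧸ m), Ideal.Quotient.algebraMap_eq,
        Ideal.Quotient.eq.2 (he m' m'), Pi.single_eq_same, map_one, one_smul]
    · intro i _ hi
      rw [TensorProduct.tmul_smul, ← algebraMap_smul (R ⧸ m), Ideal.Quotient.algebraMap_eq,
        Ideal.Quotient.eq.2 (he i m'), Pi.single_eq_of_ne hi.symm, map_zero, zero_smul]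
    · simp
  have h1 : (1 : R ⧸ m) ⊗ₜ[R] (d * d) = 1 ⊗ₜ (c m' * c m') := by
    have := congrArg (fun z ↦ z * z) hdc
    simpa using this
  rw [← hδ, hcr, htmul, htmul, Ideal.Quotient.eq_zero_iff_mem.2 hδm, map_zero] at h1
  have hnt : Nontrivial ((R ⧸ m) ⊗[R] C) := by
    refine Module.nontrivial_of_finrank_pos (R := R ⧸ m) ?_
    rw [Module.finrank_quotient_tensorProduct_eq_rankAtStalk, hrank]
    exact two_pos
  exact hr m' (Ideal.Quotient.eq_zero_iff_mem.1
    ((map_eq_zero_iff _ (algebraMap (R ⧸ m) ((R ⧸ m) ⊗[R] C)).injective).1 h1.symm))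

end SkewUnit

/-! ### Generic choices over the semilocal ring -/

section Regular

variable {R A : Type*} [CommRing R] [Ring A] [Algebra R A]

theorem sylvester_baseChange (K : Type*) [CommRing K] [Algebra R K] (s : A →ₗ[R] A) (b : A) :
    (sylvester s b).baseChange K = sylvester (s.baseChange K) (1 ⊗ₜ b) := by
  ext x
  simp [TensorProduct.tmul_sub]

theorem isSylvesterRegular_of_forall_quotient [Module.Finite R A] (s : A →ₗ[R] A) (d b : A)
    (h : ∀ m : Ideal R, m.IsMaximal →
      IsSylvesterRegular (s.baseChange (R ⧸ m)) (1 ⊗ₜ d) (1 ⊗ₜ b)) :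
    IsSylvesterRegular s d b := by
  have hbij : Function.Bijective (sylvester s b) := by
    refine LinearMap.bijective_of_forall_baseChange_quotient_surjective _ fun m hm ↦ ?_
    rw [sylvester_baseChange]
    exact (h m hm).2.1.2
  obtain ⟨w, hw⟩ := hbij.2 (2 * d)
  refine ⟨isUnit_of_forall_isUnit_quotient_tmul (R := R) b fun m hm ↦ (h m hm).1, hbij, w,
    isUnit_of_forall_isUnit_quotient_tmul (R := R) w fun m hm ↦ ?_, hw⟩
  obtain ⟨-, hbij', w', hw', hw'd⟩ := h m hm
  -- The fibrewise solution is unique, so the reduction of the global solution is the invertible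
  -- one.
  have : (1 : R ⧸ m) ⊗ₜ[R] w = w' := by
    apply hbij'.1
    rw [hw'd, ← sylvester_baseChange, LinearMap.baseChange_tmul, hw, two_mul, two_mul,
      TensorProduct.tmul_add]
  rwa [this]

theorem Ideal.Quotient.one_tmul_smul (m : Ideal R) (t : R) (x : A) :
    (1 : R ⧸ m) ⊗ₜ[R] (t • x) = Ideal.Quotient.mk m t • (1 ⊗ₜ[R] x) := by
  rw [TensorProduct.tmul_smul, ← algebraMap_smul (R ⧸ m), Ideal.Quotient.algebraMap_eq]

theorem tmul_mul_comm_of_forall {K : Type*} [CommRing K] [Algebra R K] {d : A}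
    (hcomm : ∀ x, d * x = x * d) (z : K ⊗[R] A) : (1 ⊗ₜ d) * z = z * (1 ⊗ₜ d) := by
  induction z with
  | zero => simp
  | add x y hx hy => rw [mul_add, add_mul, hx, hy]
  | tmul k x => rw [Algebra.TensorProduct.tmul_mul_tmul, Algebra.TensorProduct.tmul_mul_tmul,
      hcomm, mul_comm]

variable [Module.Finite R A] [Finite (MaximalSpectrum R)]

theorem exists_isSylvesterRegular_and_mul (hinf : ∀ m : Ideal R, m.IsMaximal → Infinite (R ⧸ m))
    (h2 : ∀ m : Ideal R, m.IsMaximal → (2 : R ⧸ m) ≠ 0) (s : A →ₗ[R] A) (d : A) (hd : IsUnit d)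
    (hcomm : ∀ x, d * x = x * d) (hs : s d = -d) (a : Aˣ) :
    ∃ b, IsSylvesterRegular s d b ∧ IsSylvesterRegular s d (a * b) := by
  -- The line d + t q joins d to a⁻¹d. Thus b = d at t = 0 and ab = d at t = 1, and each of the two
  -- lines passes through the regular element d.
  let q : A := (a⁻¹ : Aˣ) * d - d
  obtain ⟨t, ht⟩ := exists_forall_mk_notMem_of_finite hinf (fun m ↦
    {t | ¬ IsSylvesterRegular (s.baseChange (R ⧸ m)) (1 ⊗ₜ d) (1 ⊗ₜ d + t • (1 ⊗ₜ q))} ∪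
    {t | ¬ IsSylvesterRegular (s.baseChange (R ⧸ m)) (1 ⊗ₜ d)
      (1 ⊗ₜ (a * d) + t • (1 ⊗ₜ (a * q)))}) fun m hm ↦ by
    let _ := Ideal.Quotient.field m
    have hd' : IsUnit ((1 : R ⧸ m) ⊗ₜ[R] d) :=
      hd.map (Algebra.TensorProduct.includeRight : A →ₐ[R] (R ⧸ m) ⊗[R] A)
    have hs' : s.baseChange (R ⧸ m) (1 ⊗ₜ d) = -(1 ⊗ₜ d) := by
      rw [LinearMap.baseChange_tmul, hs, TensorProduct.tmul_neg]
    refine (finite_setOf_not_isSylvesterRegular (h2 m hm) _ _ hd' (tmul_mul_comm_of_forall hcomm)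
      hs' _ _ 0 (by rw [zero_smul, add_zero])).union
      (finite_setOf_not_isSylvesterRegular (h2 m hm) _ _ hd' (tmul_mul_comm_of_forall hcomm)
      hs' _ _ 1 ?_)
    rw [one_smul, ← TensorProduct.tmul_add, mul_sub, Units.mul_inv_cancel_left, add_sub_cancel]
  refine ⟨d + t • q, isSylvesterRegular_of_forall_quotient _ _ _ fun m hm ↦ ?_,
    isSylvesterRegular_of_forall_quotient _ _ _ fun m hm ↦ ?_⟩
  · by_contra h
    refine ht m hm (Or.inl ?_)
    rwa [TensorProduct.tmul_add, Ideal.Quotient.one_tmul_smul] at h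
  · by_contra h
    refine ht m hm (Or.inr ?_)
    rwa [mul_add, mul_smul_comm, TensorProduct.tmul_add, Ideal.Quotient.one_tmul_smul] at h

theorem exists_isUnit_cayley (hinf : ∀ m : Ideal R, m.IsMaximal → Infinite (R ⧸ m))
    (h2 : ∀ m : Ideal R, m.IsMaximal → (2 : R ⧸ m) ≠ 0) (d : A) (δ : R) (hδ : IsUnit δ)
    (hd : d * d = algebraMap R A δ) (hcomm : ∀ x, d * x = x * d) (u : Aˣ) :
    ∃ t : R, IsUnit (1 + (u : A) + t • (d * (1 - u))) := by
  obtain ⟨t, ht⟩ := exists_forall_mk_notMem_of_finite hinf (fun m ↦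
    {t | ¬ IsUnit ((1 : (R ⧸ m) ⊗[R] A) + (1 : R ⧸ m) ⊗ₜ[R] (u : A) +
      t • (((1 : R ⧸ m) ⊗ₜ[R] d) * (1 - (1 : R ⧸ m) ⊗ₜ[R] (u : A))))}) fun m hm ↦ by
    let _ := Ideal.Quotient.field m
    refine finite_setOf_not_isUnit_cayley (h2 m hm) _ _ (Ideal.Quotient.mk m δ)
      (hδ.map (Ideal.Quotient.mk m)).ne_zero ?_ (tmul_mul_comm_of_forall hcomm)
      (u.isUnit.map (Algebra.TensorProduct.includeRight : A →ₐ[R] (R ⧸ m) ⊗[R] A))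
    rw [Algebra.TensorProduct.tmul_mul_tmul, mul_one, hd, Algebra.algebraMap_eq_smul_one,
      Ideal.Quotient.one_tmul_smul, Algebra.algebraMap_eq_smul_one]
    rfl
  refine ⟨t, isUnit_of_forall_isUnit_quotient_tmul (R := R) _ fun m hm ↦ ?_⟩
  by_contra h
  refine ht m hm ?_
  rwa [TensorProduct.tmul_add, TensorProduct.tmul_add, Ideal.Quotient.one_tmul_smul,
    ← mul_one (1 : R ⧸ m), ← Algebra.TensorProduct.tmul_mul_tmul, TensorProduct.tmul_sub,
    mul_one, ← Algebra.TensorProduct.one_def] at h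

end Regular

/-! ### Unitary elements and the norm principle -/

namespace LinearInvolution

variable {R A : Type*} [CommRing R] [Ring A] [Algebra R A]

theorem exists_commute_of_isSylvesterRegular (σ : LinearInvolution R A) {d b : A}
    (hcomm : ∀ x, d * x = x * d) (hσd : σ d = -d) (hb : IsSylvesterRegular σ.toLinearMap d b) :
    ∃ h : A, IsUnit h ∧ σ h = h ∧ (b * h) * σ (b * h) = σ (b * h) * (b * h) := by
  obtain ⟨-, hbij, h, hu, hh⟩ := hb
  rw [sylvester_apply] at hh
  -- Applying σ to the Sylvester equation and changing sign shows that σ h solves it too.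
  have hσh : σ h = h := by
    apply hbij.1
    rw [sylvester_apply, sylvester_apply, hh]
    have h1 := congrArg σ hh
    have h3 : σ (b * h - h * σ b) = σ h * σ b - b * σ h := by
      rw [map_sub, σ.map_mul, σ.map_mul, σ.apply_apply]
    have h4 : σ (2 * d) = -(2 * d) := by
      rw [two_mul, map_add, hσd, neg_add]
    have h5 : σ h * σ b - b * σ h = -(2 * d) := h3.symm.trans (h1.trans h4)
    change b * σ h - σ h * σ b = _
    rw [← neg_sub, h5, neg_neg]
  have hσx : σ (b * h) = b * h - 2 * d := by
    rw [σ.map_mul, hσh, ← hh]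
    exact (sub_sub_cancel _ _).symm
  refine ⟨h, hu, hσh, ?_⟩
  rw [hσx, mul_sub, sub_mul, two_mul, mul_add, add_mul, hcomm]

/-- The restriction of the involution to the center, as a linear map. -/
def onCenterLinearMap (σ : LinearInvolution R A) :
    Subalgebra.center R A →ₗ[R] Subalgebra.center R A where
  toFun := σ.onCenter
  map_add' x y := Subtype.ext (map_add σ.toLinearMap (x : A) y)
  map_smul' r x := Subtype.ext (map_smul σ.toLinearMap r (x : A))

theorem onCenter_onCenter (σ : LinearInvolution R A) (c : Subalgebra.center R A) :
    σ.onCenter (σ.onCenter c) = c := Subtype.ext (σ.apply_apply _)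

theorem isUnit_apply (σ : LinearInvolution R A) {x : A} (hx : IsUnit x) : IsUnit (σ x) := by
  obtain ⟨u, rfl⟩ := hx
  refine ⟨⟨σ u, σ (u⁻¹ : Aˣ), ?_, ?_⟩, rfl⟩
  · rw [← σ.map_mul, u.inv_mul, σ.map_one]
  · rw [← σ.map_mul, u.mul_inv, σ.map_one]

theorem IsAzumayaUnitary.exists_skew_unit [Finite (MaximalSpectrum R)] {σ : LinearInvolution R A}
    (hσ : σ.IsAzumayaUnitary) (h2 : IsUnit (2 : R)) :
    ∃ (d : A) (δ : R), (∀ x, d * x = x * d) ∧ σ d = -d ∧ d * d = algebraMap R A δ ∧ IsUnit δ := by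
  have := hσ.finite
  have := hσ.etale
  have : Module.Flat R (Subalgebra.center R A) := Algebra.Smooth.flat _ _
  obtain ⟨d, δ, hd, hdd, hδ⟩ := exists_skew_mul_self_isUnit σ.onCenterLinearMap
    (fun x y ↦ _root_.map_mul σ.onCenter x y) σ.onCenter_onCenter
    (fun c hc ↦ by
      obtain ⟨r, hr⟩ := (hσ.fixed_iff c c.2).1 (congrArg Subtype.val hc)
      exact ⟨r, Subtype.ext hr⟩) h2 hσ.rank_eq_two
  refine ⟨d, δ, fun x ↦ (Subalgebra.mem_center_iff.1 d.2 x).symm, congrArg Subtype.val hd,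
    congrArg Subtype.val hdd, hδ⟩

theorem reducedNorm_apply {σ : LinearInvolution R A}
    (hex : ∃! N : A →* Subalgebra.center R A, IsReducedNorm (Subalgebra.center R A) A N) (a : A) :
    reducedNorm (Subalgebra.center R A) A (σ a) =
      σ.onCenter (reducedNorm (Subalgebra.center R A) A a) := by
  refine IsReducedNorm.apply_involution hex (Classical.epsilon_spec hex.exists)
    { σ.onCenter with
      map_zero' := map_zero σ.onCenterLinearMap
      map_add' := map_add σ.onCenterLinearMap } σ.onCenter_onCenter σ.toLinearMap.toAddMonoidHom
    σ.apply_apply σ.map_mul (fun c x ↦ ?_) a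
  change σ ((c : A) * x) = σ c * σ x
  rw [σ.map_mul]
  exact Subalgebra.mem_center_iff.1 (σ.map_mem_center c.2) _

theorem map_eq_oneSub_of_mul_apply_eq (σ : LinearInvolution R A)
    (N : A →* Subalgebra.center R A) (hN : ∀ a, N (σ a) = σ.onCenter (N a)) {u a : Aˣ} (h : (u : A) * σ a = a) :
    Units.map N u = σ.oneSub (Units.map N a) := by
  change _ = Units.map N a * (Units.map σ.onCenter (Units.map N a))⁻¹
  rw [eq_mul_inv_iff_mul_eq]
  ext1
  change N u * σ.onCenter (N a) = N a
  rw [← hN, ← _root_.map_mul, h]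

theorem oneSub_map_eq_one_of_apply_eq (σ : LinearInvolution R A)
    (N : A →* Subalgebra.center R A) (hN : ∀ a, N (σ a) = σ.onCenter (N a)) {h : Aˣ} (hh : σ h = h) :
    σ.oneSub (Units.map N h) = 1 := by
  rw [← map_eq_oneSub_of_mul_apply_eq σ N hN (u := 1) (by rw [Units.val_one, one_mul, hh]), _root_.map_one]

/-- The witness is x σ(x)⁻¹; commutation of x with σ x is exactly what makes it unitary. -/
theorem oneSub_map_mem_of_commute (σ : LinearInvolution R A)
    (N : A →* Subalgebra.center R A) (hN : ∀ a, N (σ a) = σ.onCenter (N a)) {x : Aˣ} (hx : (x : A) * σ x = σ x * x) :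
    σ.oneSub (Units.map N x) ∈ σ.unitaryGroup.map (Units.map N) := by
  obtain ⟨y, hy⟩ := σ.isUnit_apply x.isUnit
  have hxy : x * y = y * x := by
    ext
    rw [Units.val_mul, Units.val_mul, hy, hx]
  have hu : ((x * y⁻¹ : Aˣ) : A) * σ x = x := by
    rw [← hy, ← Units.val_mul, inv_mul_cancel_right]
  refine ⟨x * y⁻¹, ?_, map_eq_oneSub_of_mul_apply_eq σ N hN hu⟩
  change ((x * y⁻¹ : Aˣ) : A) * σ ((x * y⁻¹ : Aˣ) : A) = 1
  have h1 : (x : A) * σ ((x * y⁻¹ : Aˣ) : A) = y := by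
    rw [hy]
    conv_rhs => rw [← hu, σ.map_mul, σ.apply_apply]
  have h2 : x * y⁻¹ = y⁻¹ * x := by
    rw [mul_inv_eq_iff_eq_mul, mul_assoc, hxy, inv_mul_cancel_left]
  conv_lhs => enter [1]; rw [h2]
  rw [Units.val_mul, mul_assoc, h1, Units.inv_mul]

end LinearInvolution

theorem mainTheorem6 {R : Type*} {A : Type*} [CommRing R] [Ring A] [Algebra R A]
    (hsemilocal : Finite (MaximalSpectrum R))
    (hinfinite : ∀ m : Ideal R, m.IsMaximal → Infinite (R ⧸ m))
    (hchar : ∀ m : Ideal R, m.IsMaximal → ringChar (R ⧸ m) ≠ 2)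
    (σ : LinearInvolution R A) (hσ : σ.IsAzumayaUnitary) :
    (∃! N : A →* Subalgebra.center R A, IsReducedNorm (Subalgebra.center R A) A N) ∧
      σ.unitaryGroup.map (Units.map (reducedNorm (Subalgebra.center R A) A)) =
        (Units.map (reducedNorm (Subalgebra.center R A) A)).range.map σ.oneSub := by
  have := hσ.finite
  have := hσ.azumaya
  have : IsScalarTower R (Subalgebra.center R A) A := ⟨fun r c x ↦ smul_mul_assoc r (c : A) x⟩
  have : Module.Finite R A := Module.Finite.trans (Subalgebra.center R A) A
  have : Finite (MaximalSpectrum (Subalgebra.center R A)) := finite_maximalSpectrum_of_finite (R := R) _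
  have hex := IsAzumaya.existsUnique_isReducedNorm (Subalgebra.center R A) A
  refine ⟨hex, ?_⟩
  have hN := LinearInvolution.reducedNorm_apply (σ := σ) hex
  set N := reducedNorm (Subalgebra.center R A) A
  have h2 : ∀ m : Ideal R, m.IsMaximal → (2 : R ⧸ m) ≠ 0 := fun m hm ↦
    two_ne_zero_of_ringChar_ne_two hm (hchar m hm)
  have h2u : IsUnit (2 : R) := isUnit_of_forall_notMem_maximal fun m hm h ↦
    h2 m hm ((map_ofNat (Ideal.Quotient.mk m) 2).symm.trans (Ideal.Quotient.eq_zero_iff_mem.2 h))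
  obtain ⟨d, δ, hcomm, hσd, hdd, hδ⟩ := hσ.exists_skew_unit h2u
  have hd : IsUnit d := by
    have h : IsUnit (d * d) := hdd ▸ hδ.map (algebraMap R A)
    exact ((Commute.refl d).isUnit_mul_iff.1 h).1
  apply le_antisymm
  · rintro _ ⟨u, hu, rfl⟩
    have hu' : (u : A) * σ u = 1 := hu
    obtain ⟨t, a, ha⟩ := exists_isUnit_cayley hinfinite h2 d δ hδ hdd hcomm u
    refine ⟨Units.map N a, ⟨a, rfl⟩, (σ.map_eq_oneSub_of_mul_apply_eq N hN ?_).symm⟩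
    have hσa : σ a = 1 + σ u - t • (d * (1 - σ u)) := by
      rw [ha, map_add, map_add, map_smul, σ.map_mul, map_sub, σ.map_one, hσd, mul_neg, smul_neg,
        ← hcomm]
      exact (sub_eq_add_neg _ _).symm
    rw [hσa, ha, mul_sub, mul_add, hu', mul_one, mul_smul_comm, ← mul_assoc, ← hcomm, mul_assoc,
      mul_sub, hu', mul_one, add_comm (u : A), sub_eq_add_neg, ← smul_neg, ← mul_neg, neg_sub]
  · rintro _ ⟨_, ⟨a, rfl⟩, rfl⟩
    -- The units a with N(a)^{1-σ} in N(U) form a subgroup, so a = (ab)b⁻¹ reduces the claim to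
    -- regular elements.
    let K := (σ.unitaryGroup.map (Units.map N)).comap (σ.oneSub.comp (Units.map N))
    change a ∈ K
    have hreg : ∀ b : Aˣ, IsSylvesterRegular σ.toLinearMap d b → b ∈ K := by
      intro b hb
      obtain ⟨h, ⟨h, rfl⟩, hσh, hcom⟩ := σ.exists_commute_of_isSylvesterRegular hcomm hσd hb
      have hmem := σ.oneSub_map_mem_of_commute N hN (x := b * h) hcom
      rwa [map_mul, map_mul, σ.oneSub_map_eq_one_of_apply_eq N hN hσh, mul_one] at hmem
    obtain ⟨b, hb, hab⟩ := exists_isSylvesterRegular_and_mul hinfinite h2 σ.toLinearMap d hd hcomm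
      hσd a
    obtain ⟨b, rfl⟩ := hb.1
    have := K.mul_mem (hreg (a * b) hab) (K.inv_mem (hreg b hb))
    rwa [mul_inv_cancel_right] at this
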